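/- **Theorem 1 (FDR control of the S-MAP procedure).** *Model.* Let $K\ge 1$, and let $(t^{(k)},(X_n^{(k)})_{n\ge1})$, $k\in[K]=\{1,\dots,K\}$, be independent pairs of a change point $t^{(k)}\in\{1,2,\dots\}$ and a data stream. The change points are identically distributed with a known, otherwise arbitrary, prior. Given $t^{(k)}=m$, the observations of stream $k$ are independent; $X_n^{(k)}$ has probability density $f_0$ for $n<m$ and $f_1$ for $n\ge m$ (with respect to a common $\sigma$-finite measure). Put $\rho_n=P(t^{(k)}=n\mid t^{(k)}\ge n)$ and $L=f_1/f_0$. *Procedure.* Fix $\alpha\in(0,1)$ and $q\in[0,1]$, and put $Q_r=1-\frac{r\alpha}{K}$ for $r\in[K]$. Start with $\pi_0^{(k)}=0$ for all $k$ and with all $K$ streams active. In time slot $n=1,2,\dots$, let $I$ be the set of streams that are still active. 1. Observe a set $s_n\subseteq I$ of $\lceil q|I|\rceil$ active streams with the highest values $\pi_{n-1}^{(k)}$; ties are broken by a fixed measurable rule that depends on $n$, $I$ and $(\pi_{n-1}^{(k)})_{k}$ only. 2. Update the posterior probabilities of change: with $p_n^{(k)}=\pi_{n-1}^{(k)}+\rho_n(1-\pi_{n-1}^{(k)})$,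 $$\pi_n^{(k)}=\frac{L(X_n^{(k)})\,p_n^{(k)}}{L(X_n^{(k)})\,p_n^{(k)}+(1-\rho_n)(1-\pi_{n-1}^{(k)})}\ \text{ if }k\in s_n,\qquad \pi_n^{(k)}=p_n^{(k)}\ \text{ if }k\notin s_n$$ (where $f_0=0$, the first expression is read with numerator and denominator multiplied by $f_0$). 3. Sort the values $\pi_n^{(k)}$, $k\in I$, in ascending order as $\pi_n^{(i(1))}\le\dots\le\pi_n^{(i(|I|))}$. If $\pi_n^{(i(l))}\ge Q_{K-l+1}$ for some $l$, let $l_*$ be the smallest such $l$, declare changes for the streams $i(l_*),i(l_*+1),\dots,i(|I|)$ at time $n$, and make them inactive. Stop when no stream is active. Let $T^{(k)}$ be the time at which a change is declared for stream $k$ ($T^{(k)}=\infty$ if this never happens), $V=\#\{k: T^{(k)}<t^{(k)}\}$ and $R=\#\{k:T^{(k)}<\infty\}$. *Conclusion.* For every $\alpha\in(0,1)$ and every $q\in[0,1]$, the false discovery rate of this procedure satisfies $$\mathrm{FDR}=\mathrm{E}\left[\frac{V}{\max\{R,1\}}\right]\le\alpha .$$ -/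

import Mathlib

open MeasureTheory ProbabilityTheory

noncomputable section

namespace SMAP

/-! ### The Bayesian change-point model -/

/-- The probability measure with density `f` with respect to the reference measure `μ`. -/
def densityLaw {E : Type*} [MeasurableSpace E] (μ : Measure E) (f : E → ℝ) : Measure E :=
  μ.withDensity fun x => ENNReal.ofReal (f x)

/-- `f` is a probability density with respect to `μ`. -/
structure IsProbDensity {E : Type*} [MeasurableSpace E] (μ : Measure E) (f : E → ℝ) : Prop where
  measurable : Measurable f
  nonneg : ∀ x, 0 ≤ f x
  lintegral_eq_one : ∫⁻ x, ENNReal.ofReal (f x) ∂μ = 1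

/-- `K` independent data streams `X k 1, X k 2, …` with change points `t k`, distributed according
to `prior` on `{1, 2, …}`. Given `t k = m`, the observations of stream `k` are independent, with
density `f₀` before time `m` and density `f₁` from time `m` on. (Time slots are `n ≥ 1`; the
entries `X k 0` are dummies, on which nothing is assumed and nothing depends.) -/
structure IsModel {Ω E : Type*} [MeasurableSpace Ω] [MeasurableSpace E] {K : ℕ}
    (P : Measure Ω) (μ : Measure E) (f₀ f₁ : E → ℝ) (prior : Measure ℕ)
    (t : Fin K → Ω → ℕ) (X : Fin K → ℕ → Ω → E) : Prop where
  measurable_t : ∀ k, Measurable (t k)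
  measurable_X : ∀ k n, 1 ≤ n → Measurable (X k n)
  /-- change points are at least `1` -/
  prior_zero : prior {0} = 0
  /-- the change points all have the law `prior` -/
  law_t : ∀ k, P.map (t k) = prior
  /-- the pairs (change point, data stream) are independent among the streams -/
  indep_streams : iIndepFun (fun k ω => (t k ω, fun n : ℕ => X k (n + 1) ω)) P
  /-- given the change point, the observations of a stream are independent -/
  indep_given : ∀ k m, P (t k ⁻¹' {m}) ≠ 0 →
    iIndepFun (fun (n : ℕ) ω => X k (n + 1) ω) P[|t k ⁻¹' {m}]
  /-- given the change point, the observations have density `f₀` before it, `f₁` from it on -/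
  law_given : ∀ k m, P (t k ⁻¹' {m}) ≠ 0 → ∀ n, 1 ≤ n →
    (P[|t k ⁻¹' {m}]).map (X k n) = if n < m then densityLaw μ f₀ else densityLaw μ f₁

/-! ### The posterior recursion -/

/-- `ρ_n = P(t = n | t ≥ n)`. -/
def hazard (prior : Measure ℕ) (n : ℕ) : ℝ :=
  prior.real {n} / prior.real (Set.Ici n)

/-- Posterior of a stream that is not monitored, from the previous posterior `p`. -/
def predict (ρ p : ℝ) : ℝ := p + ρ * (1 - p)

/-- Posterior of a monitored stream with new observation `x`. This is
`L (p + ρ (1 - p)) / (L (p + ρ (1 - p)) + (1 - ρ) (1 - p))` for `L = f₁ x / f₀ x`, with numerator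
and denominator multiplied by `f₀ x`, so that it is also right (`L = ∞`) where `f₀ x = 0`. -/
def bayesUpdate {E : Type*} (f₀ f₁ : E → ℝ) (ρ p : ℝ) (x : E) : ℝ :=
  f₁ x * (p + ρ * (1 - p)) / (f₁ x * (p + ρ * (1 - p)) + f₀ x * ((1 - ρ) * (1 - p)))

/-! ### The S-MAP procedure -/

/-- The thresholds `Q_r = 1 - r α / K`. -/
def threshold (K : ℕ) (α : ℝ) (r : ℕ) : ℝ := 1 - r * α / K

/-- The position `l ∈ {1, …, |I|}` of `k ∈ I` when the streams in `I` are sorted by ascending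
posterior (equal posteriors are listed by index; the set of declared streams does not depend on
this choice). -/
def rank {K : ℕ} (p : Fin K → ℝ) (I : Finset (Fin K)) (k : Fin K) : ℕ :=
  open Classical in (I.filter fun j => p j < p k ∨ (p j = p k ∧ j ≤ k)).card

/-- The streams declared at a time slot with active set `I` and updated posteriors `p`: those whose
position is at least `l_* = min {l : p_(l) ≥ Q_{K-l+1}}`, i.e. those which have a stream `j` at the
same or a lower position `l` with `p j ≥ Q_{K-l+1}`. Empty if no posterior reaches its threshold. -/
def declared {K : ℕ} (α : ℝ) (p : Fin K → ℝ) (I : Finset (Fin K)) : Finset (Fin K) :=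
  open Classical in I.filter fun k =>
    ∃ j ∈ I, rank p I j ≤ rank p I k ∧ threshold K α (K - rank p I j + 1) ≤ p j

/-- `sel n p I` is the set of streams monitored at time slot `n`, when `I` is the set of active
streams and `p` the vector of current posteriors: it consists of `⌈q |I|⌉` active streams with
the highest posteriors. Any measurable way to break ties is allowed. -/
structure IsTopSelection {K : ℕ} (q : ℝ)
    (sel : ℕ → (Fin K → ℝ) → Finset (Fin K) → Finset (Fin K)) : Prop where
  subset : ∀ n p I, sel n p I ⊆ I
  card_eq : ∀ n p I, (sel n p I).card = ⌈q * (I.card : ℝ)⌉₊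
  top : ∀ n p I, ∀ i ∈ sel n p I, ∀ j ∈ I, j ∉ sel n p I → p j ≤ p i
  measurable : ∀ n I s, MeasurableSet {p | sel n p I = s}

/-- Posteriors of all streams, and the set of active streams, at the end of a time slot. -/
structure State (K : ℕ) where
  post : Fin K → ℝ
  active : Finset (Fin K)

/-- All posteriors after time slot `n`, if the streams in `s` are monitored and show `x`. -/
def updatePost {E : Type*} {K : ℕ} (f₀ f₁ : E → ℝ) (prior : Measure ℕ) (n : ℕ)
    (s : Finset (Fin K)) (x : Fin K → E) (p : Fin K → ℝ) : Fin K → ℝ := fun k =>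
  if k ∈ s then bayesUpdate f₀ f₁ (hazard prior n) (p k) (x k)
  else predict (hazard prior n) (p k)

/-- The S-MAP procedure run on the sample path `x` (`x k n` is what stream `k` shows at time slot
`n`, if it is monitored). In time slot `n + 1`: monitor, update the posteriors, remove the declared
streams. A sampling stage is a maximal run of slots up to one in which streams are declared. -/
def run {E : Type*} {K : ℕ} (f₀ f₁ : E → ℝ) (prior : Measure ℕ) (α : ℝ)
    (sel : ℕ → (Fin K → ℝ) → Finset (Fin K) → Finset (Fin K)) (x : Fin K → ℕ → E) :
    ℕ → State K
  | 0 => ⟨fun _ => 0, Finset.univ⟩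
  | n + 1 =>
    let S := run f₀ f₁ prior α sel x n
    let s := sel (n + 1) S.post S.active
    let p := updatePost f₀ f₁ prior (n + 1) s (fun k => x k (n + 1)) S.post
    ⟨p, S.active \ declared α p S.active⟩

/-- The time `T k` at which a change is declared for stream `k`; `⊤` if this never happens. -/
def declTime {E : Type*} {K : ℕ} (f₀ f₁ : E → ℝ) (prior : Measure ℕ) (α : ℝ)
    (sel : ℕ → (Fin K → ℝ) → Finset (Fin K) → Finset (Fin K)) (x : Fin K → ℕ → E)
    (k : Fin K) : ℕ∞ :=
  ⨅ (n : ℕ) (_ : k ∉ (run f₀ f₁ prior α sel x n).active), (n : ℕ∞)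

/-! ### The false discovery rate -/

/-- Number `V` of false discoveries, for declaration times `T` and change points `τ`. -/
def falseDiscoveries {K : ℕ} (T : Fin K → ℕ∞) (τ : Fin K → ℕ) : ℕ :=
  (Finset.univ.filter fun k => T k < (τ k : ℕ∞)).card

/-- Number `R` of declared change points. -/
def discoveries {K : ℕ} (T : Fin K → ℕ∞) : ℕ :=
  (Finset.univ.filter fun k => T k < ⊤).card

/-- The false discovery proportion `V / max {R, 1}`. -/
def fdp {K : ℕ} (T : Fin K → ℕ∞) (τ : Fin K → ℕ) : ℝ :=
  (falseDiscoveries T τ : ℝ) / max (discoveries T : ℝ) 1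

/-- The false discovery proportion of the S-MAP procedure, as a random variable. -/
def smapFDP {Ω E : Type*} {K : ℕ} (f₀ f₁ : E → ℝ) (prior : Measure ℕ) (α : ℝ)
    (sel : ℕ → (Fin K → ℝ) → Finset (Fin K) → Finset (Fin K))
    (t : Fin K → Ω → ℕ) (X : Fin K → ℕ → Ω → E) (ω : Ω) : ℝ :=
  fdp (declTime f₀ f₁ prior α sel fun k n => X k n ω) fun k => t k ω

/-- The false discovery rate `E[V / max {R, 1}]` of the S-MAP procedure. -/
def smapFDR {Ω E : Type*} [MeasurableSpace Ω] {K : ℕ} (P : Measure Ω)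
    (f₀ f₁ : E → ℝ) (prior : Measure ℕ) (α : ℝ)
    (sel : ℕ → (Fin K → ℝ) → Finset (Fin K) → Finset (Fin K))
    (t : Fin K → Ω → ℕ) (X : Fin K → ℕ → Ω → E) : ℝ :=
  ∫ ω, smapFDP f₀ f₁ prior α sel t X ω ∂P

end SMAP

end

/-! Let a change be declared for stream `k` in slot `n + 1`, and let `r` streams have been declared
by the end of that slot. Since `r ≤ R`, a false declaration contributes at most `1 / r` to the false
discovery proportion (`fdp_declTime_le`). If `π` is the conditional probability that the change has
occurred, `1{t k > n + 1} / r` may be replaced in expectation by `(1 - π) / r`. The stopping rule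
forces `π ≥ Q_r`, that is `1 - π ≤ r α / K` (`threshold_le_of_mem_declared`), so the factor `r`
cancels and the term is at most `α / K` times the probability of declaring `k` in slot `n + 1`. A
stream is declared at most once: summation over `n` gives `α / K`, and summation over `k` gives `α`.

The substance is that the recursion does compute a conditional probability
(`hasPosterior_othersState`). Conditioning is on `othersState`: the complete paths of the other
streams together with the state of the procedure. With the other streams known entirely, past and
future, the observation of `k` is the only new randomness in a slot, and the next state is a
function of `othersState` and this observation. Induction on time then needs one hazard step
(`hasPosterior_predict`) and one Bayes step (`setLIntegral_obs_eq_nextPost`). Conditional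
probabilities are expressed by integrals against nonnegative test functions, so no conditional
expectations or kernels occur. -/

noncomputable section

namespace SMAP

/-! ### Bayes' formula under the integral sign -/

section Bayes

variable {Ω Z E : Type*} [MeasurableSpace Ω] [MeasurableSpace Z] [MeasurableSpace E]

theorem lintegral_densityLaw {μ : Measure E} {f : E → ℝ} (hf : Measurable f)
    {g : E → ENNReal} (hg : Measurable g) :
    ∫⁻ y, g y ∂(densityLaw μ f) = ∫⁻ y, ENNReal.ofReal (f y) * g y ∂μ := by
  rw [densityLaw, lintegral_withDensity_eq_lintegral_mul _ hf.ennreal_ofReal hg]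
  rfl

/-- If on the event `D` (resp. off `D`) the observation `Y` has density `f` (resp. `g`) given `Z`,
and `D` has conditional probability `a` given `Z`, then `D` has conditional probability
`a f / (a f + c g)` given `(Z, Y)`, where `c` is the conditional probability of `Dᶜ` given `Z`. -/
theorem setLIntegral_eq_lintegral_posterior {P : Measure Ω} {μ : Measure E} [SigmaFinite μ]
    {f g : E → ℝ} (hf : Measurable f) (hg : Measurable g) (hf0 : ∀ y, 0 ≤ f y)
    (hg0 : ∀ y, 0 ≤ g y) {D : Set Ω} (hD : MeasurableSet D) {ζ : Ω → Z} {Y : Ω → E}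
    (hζ : Measurable ζ) {a c : Z → ℝ} (ha : Measurable a) (hc : Measurable c)
    (ha0 : ∀ ω, 0 ≤ a (ζ ω)) (hc0 : ∀ ω, 0 ≤ c (ζ ω))
    (hDY : ∀ F : Z × E → ENNReal, Measurable F →
      ∫⁻ ω in D, F (ζ ω, Y ω) ∂P = ∫⁻ ω in D, ∫⁻ y, F (ζ ω, y) ∂(densityLaw μ f) ∂P)
    (hDY' : ∀ F : Z × E → ENNReal, Measurable F →
      ∫⁻ ω in Dᶜ, F (ζ ω, Y ω) ∂P = ∫⁻ ω in Dᶜ, ∫⁻ y, F (ζ ω, y) ∂(densityLaw μ g) ∂P)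
    (hDZ : ∀ φ : Z → ENNReal, Measurable φ →
      ∫⁻ ω in D, φ (ζ ω) ∂P = ∫⁻ ω, ENNReal.ofReal (a (ζ ω)) * φ (ζ ω) ∂P)
    (hDZ' : ∀ φ : Z → ENNReal, Measurable φ →
      ∫⁻ ω in Dᶜ, φ (ζ ω) ∂P = ∫⁻ ω, ENNReal.ofReal (c (ζ ω)) * φ (ζ ω) ∂P)
    {w : Z × E → ℝ} (hw : Measurable w) (hw0 : ∀ ω y, 0 ≤ w (ζ ω, y))
    (hwe : ∀ ω y, w (ζ ω, y) * (a (ζ ω) * f y + c (ζ ω) * g y) = a (ζ ω) * f y)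
    {F : Z × E → ENNReal} (hF : Measurable F) :
    ∫⁻ ω in D, F (ζ ω, Y ω) ∂P = ∫⁻ ω, ENNReal.ofReal (w (ζ ω, Y ω)) * F (ζ ω, Y ω) ∂P := by
  -- On `S`, integrate out `Y` by its density `h`, then trade the restriction to `S` for the weight
  -- `b`: a double integral over all of `Ω` and `μ` remains.
  have key (h : E → ℝ) (hh : Measurable h) (b : Z → ℝ) (hb : Measurable b)
      (hb0 : ∀ ω, 0 ≤ b (ζ ω)) (S : Set Ω)
      (h1 : ∀ F : Z × E → ENNReal, Measurable F →
        ∫⁻ ω in S, F (ζ ω, Y ω) ∂P = ∫⁻ ω in S, ∫⁻ y, F (ζ ω, y) ∂(densityLaw μ h) ∂P)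
      (h2 : ∀ φ : Z → ENNReal, Measurable φ →
        ∫⁻ ω in S, φ (ζ ω) ∂P = ∫⁻ ω, ENNReal.ofReal (b (ζ ω)) * φ (ζ ω) ∂P)
      (G : Z × E → ENNReal) (hG : Measurable G) :
      ∫⁻ ω in S, G (ζ ω, Y ω) ∂P
        = ∫⁻ ω, ∫⁻ y, ENNReal.ofReal (b (ζ ω) * h y) * G (ζ ω, y) ∂μ ∂P := by
    rw [h1 G hG]
    have hm : Measurable fun z => ∫⁻ y, ENNReal.ofReal (h y) * G (z, y) ∂μ :=
      Measurable.lintegral_prod_right' (f := fun q : Z × E => ENNReal.ofReal (h q.2) * G q)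
        (by fun_prop)
    have e : ∀ ω, ∫⁻ y, G (ζ ω, y) ∂(densityLaw μ h)
        = ∫⁻ y, ENNReal.ofReal (h y) * G (ζ ω, y) ∂μ :=
      fun ω => lintegral_densityLaw hh (by fun_prop)
    simp_rw [e]
    rw [h2 _ hm]
    refine lintegral_congr fun ω => ?_
    rw [← lintegral_const_mul _ (by fun_prop)]
    refine lintegral_congr fun y => ?_
    rw [ENNReal.ofReal_mul (hb0 ω), mul_assoc]
  have hwF : Measurable fun q => ENNReal.ofReal (w q) * F q := by fun_prop
  -- The right side, split over `D` and `Dᶜ`, has integrand `(a f + c g) w F`; by `hwe` this is `a f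
  -- F`, the integrand of the left side.
  rw [← lintegral_add_compl (fun ω => ENNReal.ofReal (w (ζ ω, Y ω)) * F (ζ ω, Y ω)) hD,
    key f hf a ha ha0 D hDY hDZ F hF,
    key f hf a ha ha0 D hDY hDZ _ hwF, key g hg c hc hc0 Dᶜ hDY' hDZ' _ hwF]
  have hm : Measurable fun ω =>
      ∫⁻ y, ENNReal.ofReal (a (ζ ω) * f y) * (ENNReal.ofReal (w (ζ ω, y)) * F (ζ ω, y)) ∂μ :=
    Measurable.lintegral_prod_right' (f := fun q : Ω × E => ENNReal.ofReal (a (ζ q.1) * f q.2)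
      * (ENNReal.ofReal (w (ζ q.1, q.2)) * F (ζ q.1, q.2))) (by fun_prop)
  rw [← lintegral_add_left hm]
  refine lintegral_congr fun ω => ?_
  rw [← lintegral_add_left (by fun_prop)]
  refine lintegral_congr fun y => ?_
  have h1 := mul_nonneg (ha0 ω) (hf0 y)
  have h2 := mul_nonneg (hc0 ω) (hg0 y)
  calc ENNReal.ofReal (a (ζ ω) * f y) * F (ζ ω, y)
      = ENNReal.ofReal (w (ζ ω, y)) * ENNReal.ofReal (a (ζ ω) * f y + c (ζ ω) * g y)
          * F (ζ ω, y) := by rw [← ENNReal.ofReal_mul (hw0 ω y), hwe]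
    _ = _ := by rw [ENNReal.ofReal_add h1 h2]; ring

end Bayes

/-! ### Posteriors, hazard rates -/

theorem hazard_nonneg (prior : Measure ℕ) (n : ℕ) : 0 ≤ hazard prior n := by
  unfold hazard; positivity

theorem hazard_le_one (prior : Measure ℕ) [IsFiniteMeasure prior] (n : ℕ) :
    hazard prior n ≤ 1 := by
  unfold hazard
  exact div_le_one_of_le₀ (measureReal_mono (by simp)) measureReal_nonneg

theorem measure_singleton_eq_hazard_mul (prior : Measure ℕ) [IsFiniteMeasure prior] (n : ℕ) :
    prior {n + 1} = ENNReal.ofReal (hazard prior (n + 1)) * prior (Set.Ioi n) := by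
  have e : Set.Ici (n + 1) = Set.Ioi n := by ext; simp
  rw [← ofReal_measureReal (μ := prior) (s := Set.Ioi n),
    ← ofReal_measureReal (μ := prior) (s := {n + 1}), ← ENNReal.ofReal_mul (hazard_nonneg _ _)]
  congr 1
  unfold hazard
  rw [e]
  -- With no mass beyond `n` the hazard is `0 / 0 = 0`, and both sides vanish.
  by_cases h : prior.real (Set.Ioi n) = 0
  · have : prior.real {n + 1} ≤ prior.real (Set.Ioi n) := measureReal_mono (by simp)
    rw [h] at this ⊢
    simpa using le_antisymm this measureReal_nonneg
  · field_simp

theorem measure_Ioi_succ_eq_mul (prior : Measure ℕ) [IsFiniteMeasure prior] (n : ℕ) :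
    prior (Set.Ioi (n + 1)) = ENNReal.ofReal (1 - hazard prior (n + 1)) * prior (Set.Ioi n) := by
  have e : prior (Set.Ioi n) = prior {n + 1} + prior (Set.Ioi (n + 1)) := by
    rw [← measure_union (by simp) measurableSet_Ioi]
    congr 1
    ext i
    simp only [Set.mem_Ioi, Set.mem_union, Set.mem_singleton_iff]
    lia
  have h1 := measure_singleton_eq_hazard_mul prior n
  have h2 : prior (Set.Ioi n) = ENNReal.ofReal (hazard prior (n + 1)) * prior (Set.Ioi n)
      + ENNReal.ofReal (1 - hazard prior (n + 1)) * prior (Set.Ioi n) := by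
    rw [← add_mul, ← ENNReal.ofReal_add (hazard_nonneg _ _) (by linarith [hazard_le_one prior (n+1)])]
    simp
  rw [← h1] at h2
  rw [h2] at e
  exact ((ENNReal.add_right_inj (measure_ne_top _ _)).1 e).symm

/-! ### Range of the posterior updates, and Bayes' formula without division. -/

section Update

variable {E : Type*} {f₀ f₁ : E → ℝ} {ρ p : ℝ}

theorem predict_mem_Icc (hρ : ρ ∈ Set.Icc (0 : ℝ) 1) (hp : p ∈ Set.Icc (0 : ℝ) 1) :
    predict ρ p ∈ Set.Icc (0 : ℝ) 1 := by
  obtain ⟨h1, h2⟩ := hρ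
  obtain ⟨h3, h4⟩ := hp
  unfold predict
  constructor <;> nlinarith

theorem bayesUpdate_mem_Icc (h₀ : ∀ x, 0 ≤ f₀ x) (h₁ : ∀ x, 0 ≤ f₁ x)
    (hρ : ρ ∈ Set.Icc (0 : ℝ) 1) (hp : p ∈ Set.Icc (0 : ℝ) 1) (x : E) :
    bayesUpdate f₀ f₁ ρ p x ∈ Set.Icc (0 : ℝ) 1 := by
  have h := (predict_mem_Icc hρ hp).1
  have h1 : 0 ≤ f₁ x * (p + ρ * (1 - p)) := mul_nonneg (h₁ x) h
  have h2 : 0 ≤ f₀ x * ((1 - ρ) * (1 - p)) :=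
    mul_nonneg (h₀ x) (mul_nonneg (by linarith [hρ.2]) (by linarith [hp.2]))
  unfold bayesUpdate
  exact ⟨by positivity, div_le_one_of_le₀ (by linarith) (by linarith)⟩

/-- The division-free form survives a vanishing denominator: the numerator is one of two nonnegative
summands of it and vanishes too. -/
theorem bayesUpdate_mul (h₀ : ∀ x, 0 ≤ f₀ x) (h₁ : ∀ x, 0 ≤ f₁ x)
    (hρ : ρ ∈ Set.Icc (0 : ℝ) 1) (hp : p ∈ Set.Icc (0 : ℝ) 1) (x : E) :
    bayesUpdate f₀ f₁ ρ p x * ((p + ρ * (1 - p)) * f₁ x + (1 - ρ) * (1 - p) * f₀ x)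
      = (p + ρ * (1 - p)) * f₁ x := by
  have h := (predict_mem_Icc hρ hp).1
  have h1 : 0 ≤ f₁ x * (p + ρ * (1 - p)) := mul_nonneg (h₁ x) h
  have h2 : 0 ≤ f₀ x * ((1 - ρ) * (1 - p)) :=
    mul_nonneg (h₀ x) (mul_nonneg (by linarith [hρ.2]) (by linarith [hp.2]))
  have e : (p + ρ * (1 - p)) * f₁ x + (1 - ρ) * (1 - p) * f₀ x
      = f₁ x * (p + ρ * (1 - p)) + f₀ x * ((1 - ρ) * (1 - p)) := by ring
  rw [e]
  unfold bayesUpdate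
  by_cases hd : f₁ x * (p + ρ * (1 - p)) + f₀ x * ((1 - ρ) * (1 - p)) = 0
  · rw [hd, mul_zero]
    linarith
  · rw [div_mul_cancel₀ _ hd, mul_comm]

end Update

/-! ### Declared streams -/

section Declared

variable {K : ℕ} {p : Fin K → ℝ} {I : Finset (Fin K)} {i j k : Fin K}

theorem rank_le_rank (h : p i < p j ∨ (p i = p j ∧ i ≤ j)) : rank p I i ≤ rank p I j := by
  classical
  unfold rank
  refine Finset.card_le_card fun l hl => ?_
  simp only [Finset.mem_filter] at hl ⊢
  grind

/-- Contrapositive of `rank_le_rank`, since the lexicographic order by value and index is total. -/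
theorem lt_of_rank_lt_rank (h : rank p I i < rank p I j) : p i < p j ∨ (p i = p j ∧ i < j) := by
  by_contra hc
  refine absurd h (not_lt.2 (rank_le_rank ?_))
  grind

/-- Every stream of smaller rank is counted in the rank of `j`, and so is `j` itself, which makes
the inequality strict. -/
theorem card_rank_lt_lt_rank (hj : j ∈ I) :
    (I.filter fun i => rank p I i < rank p I j).card < rank p I j := by
  classical
  conv_rhs => unfold rank
  refine Finset.card_lt_card ?_
  rw [Finset.ssubset_iff_of_subset]
  · exact ⟨j, by simp [hj], by simp⟩
  · intro i hi
    simp only [Finset.mem_filter] at hi ⊢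
    exact ⟨hi.1, (lt_of_rank_lt_rank hi.2).imp_right fun h => ⟨h.1, h.2.le⟩⟩

/-- A declared stream passes the threshold for the number of streams declared so far. -/
theorem threshold_le_of_mem_declared {α : ℝ} (hα : 0 ≤ α) (hk : k ∈ declared α p I) :
    threshold K α (K - (I \ declared α p I).card) ≤ p k := by
  classical
  simp only [declared, Finset.mem_filter] at hk
  obtain ⟨-, j, hj, hjk, ht⟩ := hk
  -- The witness `j` that lets `k` be declared lies no higher than `k`. If the ranks agree, `p k < p
  -- j` is impossible: `j` would be counted in its own rank but not in that of `k`.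
  have hpjk : p j ≤ p k := by
    rcases hjk.lt_or_eq with h | h
    · rcases lt_of_rank_lt_rank h with h | h
      · exact h.le
      · exact h.1.le
    · by_contra hc
      have : (I.filter fun i => rank p I i < rank p I j).card < rank p I j :=
        card_rank_lt_lt_rank hj
      have hss : rank p I k < rank p I j := by
        unfold rank
        refine Finset.card_lt_card ?_
        rw [Finset.ssubset_iff_of_subset]
        · refine ⟨j, by simp [hj], ?_⟩
          simp only [Finset.mem_filter]
          grind
        · intro i hi
          simp only [Finset.mem_filter] at hi ⊢
          grind
      omega
  -- A stream that stays active must rank strictly below `j`, otherwise `j` would have it declared.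
  -- So at most `l - 1` streams survive, `l` being the rank of `j`; hence `K - l + 1` is at most the
  -- number of inactive streams, and `Q_r` decreases in `r`.
  have hcard : (I \ declared α p I).card < rank p I j := by
    refine lt_of_le_of_lt (Finset.card_le_card fun i hi => ?_) (card_rank_lt_lt_rank hj)
    simp only [declared, Finset.mem_sdiff, Finset.mem_filter, not_and, not_exists] at hi ⊢
    refine ⟨hi.1, ?_⟩
    by_contra hc
    exact hi.2 hi.1 j hj (not_lt.1 hc) ht
  refine le_trans ?_ (ht.trans hpjk)
  unfold threshold
  have : ((K - rank p I j + 1 : ℕ) : ℝ) ≤ ((K - (I \ declared α p I).card : ℕ) : ℝ) := by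
    have hr : rank p I j ≤ K := by
      unfold rank
      exact (Finset.card_le_univ _).trans (by simp)
    exact_mod_cast (by omega)
  gcongr

end Declared

/-! ### Measurability of the procedure -/

instance finsetMeasurableSpace {ι : Type*} : MeasurableSpace (Finset ι) := ⊤

instance finsetDiscreteMeasurableSpace {ι : Type*} : DiscreteMeasurableSpace (Finset ι) :=
  ⟨fun _ => trivial⟩

section Measurability

variable {E : Type*} {K : ℕ}

theorem measurable_rank (I : Finset (Fin K)) (k : Fin K) :
    Measurable fun p : Fin K → ℝ => rank p I k := by
  classical
  unfold rank
  simp_rw [Finset.card_filter]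
  refine Finset.measurable_sum _ fun j _ => Measurable.ite ?_ measurable_const measurable_const
  refine (measurableSet_lt (measurable_pi_apply j) (measurable_pi_apply k)).union ?_
  exact (measurableSet_eq_fun (measurable_pi_apply j) (measurable_pi_apply k)).inter
    (MeasurableSet.const _)

theorem measurable_finset_of_mem {Ω ι : Type*} [MeasurableSpace Ω] [Finite ι] {A : Ω → Finset ι}
    (h : ∀ i, MeasurableSet {ω | i ∈ A ω}) : Measurable A := by
  refine measurable_to_countable' fun s => ?_
  have e : A ⁻¹' {s} = ⋂ i, {ω | i ∈ A ω ↔ i ∈ s} := by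
    ext ω
    simp [Finset.ext_iff]
  rw [e]
  refine MeasurableSet.iInter fun i => ?_
  by_cases hi : i ∈ s
  · simpa [hi] using h i
  · have e' : {ω | i ∈ A ω ↔ i ∈ s} = {ω | i ∈ A ω}ᶜ := by ext; simp [hi]
    exact e' ▸ (h i).compl

theorem measurable_declared (α : ℝ) (I : Finset (Fin K)) :
    Measurable fun p : Fin K → ℝ => declared α p I := by
  refine measurable_finset_of_mem fun k => ?_
  simp only [declared, Finset.mem_filter, Set.ofPred_and, Set.ofPred_exists]
  refine (MeasurableSet.const _).inter <| MeasurableSet.iUnion fun j =>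
    (MeasurableSet.const _).inter <| MeasurableSet.inter ?_ ?_
  · exact measurableSet_le (measurable_rank I j) (measurable_rank I k)
  · refine measurableSet_le ?_ (measurable_pi_apply j)
    exact (Measurable.of_discrete (f := fun r : ℕ => threshold K α (K - r + 1))).comp
      (measurable_rank I j)

/-- One time slot of the procedure, on pairs (posteriors, active streams). -/
def slot (f₀ f₁ : E → ℝ) (prior : Measure ℕ) (α : ℝ)
    (sel : ℕ → (Fin K → ℝ) → Finset (Fin K) → Finset (Fin K)) (n : ℕ)
    (s : (Fin K → ℝ) × Finset (Fin K)) (y : Fin K → E) : (Fin K → ℝ) × Finset (Fin K) :=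
  let p := updatePost f₀ f₁ prior n (sel n s.1 s.2) y s.1
  (p, s.2 \ declared α p s.2)

/-- The state of the procedure as a pair. -/
def runPair (f₀ f₁ : E → ℝ) (prior : Measure ℕ) (α : ℝ)
    (sel : ℕ → (Fin K → ℝ) → Finset (Fin K) → Finset (Fin K)) (x : Fin K → ℕ → E) (n : ℕ) :
    (Fin K → ℝ) × Finset (Fin K) :=
  ((run f₀ f₁ prior α sel x n).post, (run f₀ f₁ prior α sel x n).active)

variable {f₀ f₁ : E → ℝ} {prior : Measure ℕ} {α q : ℝ}
  {sel : ℕ → (Fin K → ℝ) → Finset (Fin K) → Finset (Fin K)}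

theorem runPair_succ (x : Fin K → ℕ → E) (n : ℕ) :
    runPair f₀ f₁ prior α sel x (n + 1)
      = slot f₀ f₁ prior α sel (n + 1) (runPair f₀ f₁ prior α sel x n) (fun k => x k (n + 1)) :=
  rfl

/-- The procedure does not anticipate, and it never reads the dummies at time `0`; this is what
permits erasing the future of a stream. -/
theorem runPair_congr {x x' : Fin K → ℕ → E} {n : ℕ}
    (h : ∀ k i, 1 ≤ i → i ≤ n → x k i = x' k i) :
    runPair f₀ f₁ prior α sel x n = runPair f₀ f₁ prior α sel x' n := by
  induction n with
  | zero => rfl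
  | succ n ih =>
    rw [runPair_succ, runPair_succ, ih fun k i h1 h2 => h k i h1 (by omega)]
    congr 1
    funext k
    exact h k (n + 1) (by omega) le_rfl

/-- There are countably many active sets, so measurability in the posteriors for each fixed one
suffices. -/
theorem measurable_sel (hsel : IsTopSelection q sel) (n : ℕ) :
    Measurable fun s : (Fin K → ℝ) × Finset (Fin K) => sel n s.1 s.2 :=
  measurable_from_prod_countable_left fun I =>
    measurable_to_countable' fun s => hsel.measurable n I s

theorem measurable_updatePost [MeasurableSpace E] (hf₀ : Measurable f₀) (hf₁ : Measurable f₁)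
    {Ω : Type*} [MeasurableSpace Ω] (n : ℕ) {S : Ω → Finset (Fin K)} (hS : Measurable S)
    {y : Ω → Fin K → E} (hy : Measurable y) {p : Ω → Fin K → ℝ} (hp : Measurable p) :
    Measurable fun ω => updatePost f₀ f₁ prior n (S ω) (y ω) (p ω) := by
  refine measurable_pi_lambda _ fun k => ?_
  have hmem : MeasurableSet {s : Finset (Fin K) | k ∈ s} := MeasurableSet.of_discrete
  have hpk : Measurable fun ω => p ω k := (measurable_pi_apply k).comp hp
  have hyk : Measurable fun ω => y ω k := (measurable_pi_apply k).comp hy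
  simp only [updatePost]
  refine Measurable.ite (hS hmem) ?_ ?_
  · unfold bayesUpdate
    have h0 : Measurable fun ω => f₀ (y ω k) := hf₀.comp hyk
    have h1 : Measurable fun ω => f₁ (y ω k) := hf₁.comp hyk
    fun_prop
  · unfold predict
    fun_prop

theorem measurable_slot [MeasurableSpace E] (hf₀ : Measurable f₀) (hf₁ : Measurable f₁)
    (hsel : IsTopSelection q sel) (n : ℕ) :
    Measurable fun r : ((Fin K → ℝ) × Finset (Fin K)) × (Fin K → E) =>
      slot f₀ f₁ prior α sel n r.1 r.2 := by
  have hp : Measurable fun r : ((Fin K → ℝ) × Finset (Fin K)) × (Fin K → E) =>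
      updatePost f₀ f₁ prior n (sel n r.1.1 r.1.2) r.2 r.1.1 :=
    measurable_updatePost hf₀ hf₁ n ((measurable_sel hsel n).comp measurable_fst)
      measurable_snd measurable_fst.fst
  have hd : Measurable fun r : (Fin K → ℝ) × Finset (Fin K) => declared α r.1 r.2 :=
    measurable_from_prod_countable_left fun I => measurable_declared α I
  have hsd : Measurable fun A : Finset (Fin K) × Finset (Fin K) => A.1 \ A.2 :=
    Measurable.of_discrete
  have hA : Measurable fun r : ((Fin K → ℝ) × Finset (Fin K)) × (Fin K → E) => r.1.2 :=
    measurable_fst.snd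
  have hD := hd.comp (hp.prodMk hA)
  exact hp.prodMk (hsd.comp (hA.prodMk hD))

theorem measurable_runPair [MeasurableSpace E] (hf₀ : Measurable f₀) (hf₁ : Measurable f₁)
    (hsel : IsTopSelection q sel) (n : ℕ) :
    Measurable fun x : Fin K → ℕ → E => runPair f₀ f₁ prior α sel x n := by
  induction n with
  | zero =>
    exact measurable_const (a := ((fun _ => 0, Finset.univ) : (Fin K → ℝ) × Finset (Fin K)))
  | succ n ih =>
    simp_rw [runPair_succ]
    have : Measurable fun (x : Fin K → ℕ → E) (k : Fin K) => x k (n + 1) := by fun_prop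
    exact (measurable_slot hf₀ hf₁ hsel (n + 1)).comp (ih.prodMk this)

theorem post_mem_Icc [IsFiniteMeasure prior] (h₀ : ∀ x, 0 ≤ f₀ x) (h₁ : ∀ x, 0 ≤ f₁ x)
    (x : Fin K → ℕ → E) (n : ℕ) (k : Fin K) :
    (runPair f₀ f₁ prior α sel x n).1 k ∈ Set.Icc (0 : ℝ) 1 := by
  induction n with
  | zero => simp [runPair, run]
  | succ n ih =>
    have hρ : hazard prior (n + 1) ∈ Set.Icc (0 : ℝ) 1 := ⟨hazard_nonneg _ _, hazard_le_one _ _⟩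
    rw [runPair_succ]
    simp only [slot, updatePost]
    split_ifs
    · exact bayesUpdate_mem_Icc h₀ h₁ hρ ih _
    · exact predict_mem_Icc hρ ih

end Measurability

/-! ### Conditional laws in the change-point model -/

theorem setLIntegral_preimage_eq_tsum {Ω : Type*} [MeasurableSpace Ω] {P : Measure Ω}
    {τ : Ω → ℕ} (hτ : Measurable τ) (S : Set ℕ) (g : Ω → ENNReal) :
    ∫⁻ ω in τ ⁻¹' S, g ω ∂P = ∑' m : S, ∫⁻ ω in τ ⁻¹' {(m : ℕ)}, g ω ∂P := by
  rw [← Set.biUnion_preimage_singleton,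
    lintegral_biUnion S.to_countable (fun m _ => hτ (measurableSet_singleton m))]
  intro i _ j _ hij
  exact Set.disjoint_left.2 fun ω h1 h2 => hij (h1.symm.trans h2)

theorem setLIntegral_eq_mul_cond {Ω : Type*} [MeasurableSpace Ω] {P : Measure Ω}
    [IsFiniteMeasure P] (D : Set Ω) (g : Ω → ENNReal) :
    ∫⁻ ω in D, g ω ∂P = P D * ∫⁻ ω, g ω ∂P[|D] := by
  by_cases h : P D = 0
  · rw [h, zero_mul]
    exact setLIntegral_measure_zero _ _ h
  · rw [ProbabilityTheory.cond, lintegral_smul_measure, smul_eq_mul, ← mul_assoc,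
      ENNReal.mul_inv_cancel h (measure_ne_top _ _), one_mul]

theorem isProbabilityMeasure_densityLaw {E : Type*} [MeasurableSpace E] {μ : Measure E}
    {f : E → ℝ} (hf : IsProbDensity μ f) : IsProbabilityMeasure (densityLaw μ f) :=
  ⟨by rw [densityLaw, withDensity_apply _ MeasurableSet.univ, Measure.restrict_univ,
    hf.lintegral_eq_one]⟩

/-- If `W` is independent of `V`, and `V₀` and `Y` are independent functions of `V`, then `(W, V₀)`
is independent of `Y`. -/
theorem indepFun_prodMk_of_comp {Ω A B C D : Type*} [MeasurableSpace Ω] [MeasurableSpace A]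
    [MeasurableSpace B] [MeasurableSpace C] [MeasurableSpace D] {Q : Measure Ω}
    [IsProbabilityMeasure Q] {W : Ω → A} {V : Ω → B} (hW : Measurable W) (hV : Measurable V)
    (hWV : IndepFun W V Q) {g : B → C} {h : B → D} (hg : Measurable g) (hh : Measurable h)
    (hgh : IndepFun (g ∘ V) (h ∘ V) Q) : IndepFun (fun ω => (W ω, g (V ω))) (h ∘ V) Q := by
  have hgV := hg.comp hV
  have hhV := hh.comp hV
  have h1 : IndepFun W (fun ω => (g (V ω), h (V ω))) Q := hWV.comp measurable_id (hg.prodMk hh)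
  have h2 : IndepFun W (g ∘ V) Q := hWV.comp measurable_id hg
  have hWg : Measurable fun ω => (W ω, g (V ω)) := hW.prodMk hgV
  rw [indepFun_iff_map_prod_eq_prod_map_map hWg.aemeasurable hhV.aemeasurable]
  have hghV : Measurable fun ω => (g (V ω), h (V ω)) := hgV.prodMk hhV
  rw [indepFun_iff_map_prod_eq_prod_map_map hW.aemeasurable hghV.aemeasurable] at h1
  rw [indepFun_iff_map_prod_eq_prod_map_map hW.aemeasurable hgV.aemeasurable] at h2
  rw [indepFun_iff_map_prod_eq_prod_map_map hgV.aemeasurable hhV.aemeasurable] at hgh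
  have := Measure.isProbabilityMeasure_map (μ := Q) hW.aemeasurable
  have := Measure.isProbabilityMeasure_map (μ := Q) hgV.aemeasurable
  have := Measure.isProbabilityMeasure_map (μ := Q) hhV.aemeasurable
  -- The joint law is a threefold product bracketed to the right; only the bracketing has to be
  -- changed.
  have e : (Q.map fun ω => ((W ω, g (V ω)), (h ∘ V) ω))
      = (Q.map fun ω => (W ω, (g (V ω), h (V ω)))).map MeasurableEquiv.prodAssoc.symm := by
    rw [Measure.map_map (by fun_prop) (hW.prodMk hghV)]
    rfl
  have h2' : (Q.map fun ω => (W ω, g (V ω))) = (Q.map W).prod (Q.map (g ∘ V)) := h2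
  have hgh' : (Q.map fun ω => (g (V ω), h (V ω))) = (Q.map (g ∘ V)).prod (Q.map (h ∘ V)) := hgh
  rw [e, h1, h2', hgh', ← Measure.prodAssoc_prod, Measure.map_map (by fun_prop) (by fun_prop)]
  simp

/-- Conditioning on an event of a random variable `τ` such that `(τ, V)` is independent of `W`. -/
theorem indepFun_cond_of_prodMk {Ω A B : Type*} [MeasurableSpace Ω] [MeasurableSpace A]
    [MeasurableSpace B] {P : Measure Ω} [IsProbabilityMeasure P] {W : Ω → A} {V : Ω → B}
    {τ : Ω → ℕ} (hτ : Measurable τ) (hW : Measurable W)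
    (h : IndepFun W (fun ω => (τ ω, V ω)) P) {m : ℕ} (hm : P (τ ⁻¹' {m}) ≠ 0) :
    IndepFun W V P[|τ ⁻¹' {m}] ∧ (P[|τ ⁻¹' {m}]).map W = P.map W := by
  have hD : MeasurableSet (τ ⁻¹' {m}) := hτ (measurableSet_singleton m)
  -- Independence of `W` from `(τ, V)` is tested on `{m} ×ˢ u`; the case `u = Set.univ` shows that
  -- conditioning leaves the law of `W` unchanged.
  have key (s : Set A) (u : Set B) (hs : MeasurableSet s) (hu : MeasurableSet u) :
      P[|τ ⁻¹' {m}] (W ⁻¹' s ∩ V ⁻¹' u) = P (W ⁻¹' s) * P[|τ ⁻¹' {m}] (V ⁻¹' u) := by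
    have := h.measure_inter_preimage_eq_mul s ({m} ×ˢ u) hs ((measurableSet_singleton m).prod hu)
    have e : (fun ω => (τ ω, V ω)) ⁻¹' ({m} ×ˢ u) = τ ⁻¹' {m} ∩ V ⁻¹' u := rfl
    rw [cond_apply hD, cond_apply hD, ← e, mul_left_comm, ← this, e]
    congr 2
    ext
    simp
    tauto
  have hW' (s : Set A) (hs : MeasurableSet s) : P[|τ ⁻¹' {m}] (W ⁻¹' s) = P (W ⁻¹' s) := by
    have := cond_isProbabilityMeasure hm
    simpa using key s Set.univ hs MeasurableSet.univ
  constructor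
  · rw [indepFun_iff_measure_inter_preimage_eq_mul]
    intro s u hs hu
    rw [key s u hs hu, hW' s hs]
  · ext s hs
    rw [Measure.map_apply hW hs, Measure.map_apply hW hs, hW' s hs]

/-! ### Paths with the future of one stream erased. -/

section Paths

variable {Ω E : Type*} {K : ℕ} {X : Fin K → ℕ → Ω → E}

/-- The sample paths with the observations of stream `k` after time `n` (and all the entries at
time `0`) erased. -/
def knownPath (X : Fin K → ℕ → Ω → E) (e : E) (k : Fin K) (n : ℕ) (ω : Ω) : Fin K → ℕ → E :=
  fun j i => if i = 0 ∨ (j = k ∧ n < i) then e else X j i ω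

/-- The known part of the paths is composed of the other streams and the first observations. -/
def glue (k : Fin K) (r : (Fin K → ℕ → E) × (ℕ → E)) : Fin K → ℕ → E :=
  fun j i => if j = k ∧ i ≠ 0 then r.2 (i - 1) else r.1 j i

/-- The first `n` entries of a sequence, all others replaced by `e`. -/
def firstEntries (e : E) (n : ℕ) (v : ℕ → E) : ℕ → E := fun i => if i < n then v i else e

theorem knownPath_eq_glue (e : E) (k : Fin K) (n : ℕ) (ω : Ω) :
    knownPath X e k n ω
      = glue k (knownPath X e k 0 ω, firstEntries e n fun i => X k (i + 1) ω) := by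
  funext j i
  simp only [knownPath, glue, firstEntries]
  by_cases hj : j = k
  · by_cases hi : i = 0
    · simp [hi]
    · subst hj
      have e1 : i - 1 + 1 = i := by omega
      simp only [hi, e1, true_and, false_or, not_false_iff, if_true, ne_eq]
      grind
  · simp [hj]

end Paths

/-! ### Laws of the known paths and of the next observation, given the change point. -/

section Model

variable {Ω E : Type*} [MeasurableSpace Ω] [MeasurableSpace E] {K : ℕ}
  {P : Measure Ω} {μ : Measure E} {f₀ f₁ : E → ℝ} {prior : Measure ℕ}
  {t : Fin K → Ω → ℕ} {X : Fin K → ℕ → Ω → E}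

theorem measurable_knownPath (h : IsModel P μ f₀ f₁ prior t X) (e : E) (k : Fin K) (n : ℕ) :
    Measurable (knownPath X e k n) := by
  refine measurable_pi_lambda _ fun j => measurable_pi_lambda _ fun i => ?_
  unfold knownPath
  split_ifs with hi
  · exact measurable_const
  · exact h.measurable_X j i (by omega)

/-- The law of the observation at time `n` for a stream with change point `m`. -/
def obsLaw (μ : Measure E) (f₀ f₁ : E → ℝ) (m n : ℕ) : Measure E :=
  if n < m then densityLaw μ f₀ else densityLaw μ f₁

/-- At `n = 0` all of stream `k` is erased, so the known path is a function of the other streams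
only. -/
theorem indepFun_knownPath_zero (h : IsModel P μ f₀ f₁ prior t X) (e : E) (k : Fin K) :
    IndepFun (knownPath X e k 0) (fun ω => (t k ω, fun n : ℕ => X k (n + 1) ω)) P := by
  classical
  have hm : ∀ j, Measurable fun ω => (t j ω, fun n : ℕ => X j (n + 1) ω) := fun j =>
    (h.measurable_t j).prodMk
      (measurable_pi_lambda _ fun n => h.measurable_X j (n + 1) (by omega))
  have h1 := h.indep_streams.indepFun_finset (Finset.univ.erase k) {k} (by simp) hm
  let g : ((j : (Finset.univ.erase k : Finset (Fin K))) → ℕ × (ℕ → E)) → Fin K → ℕ → E :=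
    fun r j i => if hj : j = k then e else
      if i = 0 then e else (r ⟨j, by simp [hj]⟩).2 (i - 1)
  have hg : Measurable g := by
    refine measurable_pi_lambda _ fun j => measurable_pi_lambda _ fun i => ?_
    by_cases hj : j = k
    · simp only [g, hj, dite_true]
      exact measurable_const
    · by_cases hi : i = 0
      · simp only [g, hj, hi, dite_false, if_true]
        exact measurable_const
      · simp only [g, hj, hi, dite_false, if_false]
        exact (measurable_pi_apply _).comp (measurable_pi_apply _).snd
  let ev : ((j : ({k} : Finset (Fin K))) → ℕ × (ℕ → E)) → ℕ × (ℕ → E) :=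
    fun r => r ⟨k, by simp⟩
  have hev : Measurable ev := measurable_pi_apply _
  have h2 := h1.comp hg hev
  suffices e1 : knownPath X e k 0
      = g ∘ fun ω (j : (Finset.univ.erase k : Finset (Fin K))) =>
          (t j ω, fun n : ℕ => X j (n + 1) ω) by
    rw [e1]
    exact h2
  funext ω j i
  simp only [knownPath, Function.comp, g]
  by_cases hj : j = k
  · simp only [hj, dite_true]
    split_ifs with hc
    · rfl
    · exact absurd (or_iff_not_imp_left.2 fun hi => ⟨trivial, Nat.pos_of_ne_zero hi⟩) hc
  · by_cases hi : i = 0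
    · simp [hi]
    · simp [hj, hi, Nat.sub_add_cancel (Nat.one_le_iff_ne_zero.2 hi)]

theorem measurable_glue (k : Fin K) : Measurable (glue (E := E) k) := by
  refine measurable_pi_lambda _ fun j => measurable_pi_lambda _ fun i => ?_
  unfold glue
  split_ifs
  · exact (measurable_pi_apply _).comp measurable_snd
  · exact (measurable_pi_apply i).comp ((measurable_pi_apply j).comp measurable_fst)

theorem measurable_firstEntries (e : E) (n : ℕ) : Measurable (firstEntries e n) := by
  refine measurable_pi_lambda _ fun i => ?_
  unfold firstEntries
  split_ifs
  · exact measurable_pi_apply i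
  · exact measurable_const

/-- Given the change point of stream `k`, its observation at time `n + 1` is independent of its
previous ones and of the other streams. -/
theorem indepFun_knownPath_cond [IsProbabilityMeasure P] (h : IsModel P μ f₀ f₁ prior t X)
    (e : E) (k : Fin K) (n : ℕ) {m : ℕ} (hm : P (t k ⁻¹' {m}) ≠ 0) :
    IndepFun (knownPath X e k n) (X k (n + 1)) P[|t k ⁻¹' {m}] := by
  have := cond_isProbabilityMeasure hm
  have hX : ∀ i, Measurable (X k (i + 1)) := fun i => h.measurable_X k _ (by omega)
  have hW := measurable_knownPath h e k 0
  have h1 := (indepFun_cond_of_prodMk (h.measurable_t k) hW (indepFun_knownPath_zero h e k) hm).1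
  have h2 := (h.indep_given k m hm).indepFun_finset (Finset.range n) {n} (by simp) hX
  let g : ((i : Finset.range n) → E) → ℕ → E := fun r i =>
    if hi : i < n then r ⟨i, by simpa using hi⟩ else e
  have hg : Measurable g := by
    refine measurable_pi_lambda _ fun i => ?_
    simp only [g]
    split_ifs
    · exact measurable_pi_apply _
    · exact measurable_const
  let ev : ((i : ({n} : Finset ℕ)) → E) → E := fun r => r ⟨n, by simp⟩
  have hev : Measurable ev := measurable_pi_apply _
  have h3 := h2.comp hg hev
  have h4 := indepFun_prodMk_of_comp (Q := P[|t k ⁻¹' {m}]) hW (measurable_pi_lambda _ hX) h1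
    (g := firstEntries e n) (h := fun v => v n) (measurable_firstEntries e n)
    (measurable_pi_apply n) h3
  have h5 := h4.comp (measurable_glue k) measurable_id
  have e1 : knownPath X e k n = glue k ∘ fun ω =>
      (knownPath X e k 0 ω, firstEntries e n fun i => X k (i + 1) ω) :=
    funext fun ω => knownPath_eq_glue e k n ω
  rw [e1]
  exact h5

/-- Given the change point of stream `k`, its previous observations and the other streams have a
law that is the same for all change points after time `n`. -/
theorem exists_map_knownPath_cond [IsProbabilityMeasure P] (h : IsModel P μ f₀ f₁ prior t X)
    (e : E) (k : Fin K) (n : ℕ) :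
    ∃ κ : Measure (Fin K → ℕ → E), ∀ m, n < m → P (t k ⁻¹' {m}) ≠ 0 →
      (P[|t k ⁻¹' {m}]).map (knownPath X e k n) = κ := by
  -- The common law: other streams as under `P`, independent of `n` observations with density `f₀`,
  -- then the filler. Index `i < n` stands for time `i + 1 ≤ n < m`, before the change.
  refine ⟨((P.map (knownPath X e k 0)).prod (Measure.infinitePi fun i =>
    if i < n then densityLaw μ f₀ else Measure.dirac e)).map (glue k), fun m hnm hm => ?_⟩
  have := cond_isProbabilityMeasure hm
  have hX : ∀ i, Measurable (X k (i + 1)) := fun i => h.measurable_X k _ (by omega)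
  have hW := measurable_knownPath h e k 0
  obtain ⟨h1, h2⟩ :=
    indepFun_cond_of_prodMk (h.measurable_t k) hW (indepFun_knownPath_zero h e k) hm
  let V₀ : Ω → ℕ → E := fun ω => firstEntries e n fun i => X k (i + 1) ω
  have hV₀ : Measurable V₀ := (measurable_firstEntries e n).comp (measurable_pi_lambda _ hX)
  have h3 : IndepFun (knownPath X e k 0) V₀ P[|t k ⁻¹' {m}] :=
    h1.comp measurable_id (measurable_firstEntries e n)
  rw [indepFun_iff_map_prod_eq_prod_map_map hW.aemeasurable hV₀.aemeasurable, h2] at h3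
  have hi := (h.indep_given k m hm).comp (fun i y => if i < n then y else e) fun i => by
    split_ifs
    · exact measurable_id
    · exact measurable_const
  have hi' := hi.map_fun_eq_infinitePi_map fun i => by
    simp only [Function.comp_def]
    split_ifs
    · exact hX i
    · exact measurable_const
  have h4 : (P[|t k ⁻¹' {m}]).map V₀ = Measure.infinitePi fun i =>
      if i < n then densityLaw μ f₀ else Measure.dirac e := by
    refine Eq.trans hi' (congrArg _ (funext fun i => ?_))
    simp only [Function.comp_def]
    split_ifs with hin
    · rw [show (fun ω => X k (i + 1) ω) = X k (i + 1) from rfl,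
        h.law_given k m hm (i + 1) (by omega), if_pos (by omega)]
    · simp
  rw [← h4, ← h3, Measure.map_map (measurable_glue k) (hW.prodMk hV₀)]
  congr 1
  exact funext fun ω => knownPath_eq_glue e k n ω

/-- Given the change point, the next observation is independent of the known path, so it can be
integrated out by its own law; change points of probability zero contribute nothing. -/
theorem setLIntegral_knownPath_obs_singleton [IsProbabilityMeasure P]
    (h : IsModel P μ f₀ f₁ prior t X) (hf₀ : IsProbDensity μ f₀) (hf₁ : IsProbDensity μ f₁)
    (e : E) (k : Fin K) (n m : ℕ)
    {F : (Fin K → ℕ → E) × E → ENNReal} (hF : Measurable F) :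
    ∫⁻ ω in t k ⁻¹' {m}, F (knownPath X e k n ω, X k (n + 1) ω) ∂P
      = ∫⁻ ω in t k ⁻¹' {m}, ∫⁻ y, F (knownPath X e k n ω, y) ∂(obsLaw μ f₀ f₁ m (n + 1)) ∂P := by
  rw [setLIntegral_eq_mul_cond, setLIntegral_eq_mul_cond]
  by_cases hm : P (t k ⁻¹' {m}) = 0
  · simp [hm]
  have := cond_isProbabilityMeasure hm
  have := isProbabilityMeasure_densityLaw hf₀
  have := isProbabilityMeasure_densityLaw hf₁
  have : IsProbabilityMeasure (obsLaw μ f₀ f₁ m (n + 1)) := by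
    unfold obsLaw
    split_ifs <;> infer_instance
  have hU := measurable_knownPath h e k n
  have hX := h.measurable_X k (n + 1) (by omega)
  have hi := indepFun_knownPath_cond h e k n hm
  rw [indepFun_iff_map_prod_eq_prod_map_map hU.aemeasurable hX.aemeasurable,
    show (P[|t k ⁻¹' {m}]).map (X k (n + 1)) = obsLaw μ f₀ f₁ m (n + 1) from
      h.law_given k m hm (n + 1) (by omega)] at hi
  congr 1
  rw [← lintegral_map hF (hU.prodMk hX), hi, lintegral_prod _ hF.aemeasurable,
    lintegral_map hF.lintegral_prod_right' hU]

/-- The law of the observation at time `n + 1` is the same for all change points beyond `n + 1`, so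
the identity can be summed over them; likewise in `setLIntegral_knownPath_obs_of_le` for those up to
`n + 1`. -/
theorem setLIntegral_knownPath_obs_of_lt [IsProbabilityMeasure P]
    (h : IsModel P μ f₀ f₁ prior t X) (hf₀ : IsProbDensity μ f₀) (hf₁ : IsProbDensity μ f₁)
    (e : E) (k : Fin K) (n : ℕ)
    {F : (Fin K → ℕ → E) × E → ENNReal} (hF : Measurable F) :
    ∫⁻ ω in t k ⁻¹' Set.Ioi (n + 1), F (knownPath X e k n ω, X k (n + 1) ω) ∂P
      = ∫⁻ ω in t k ⁻¹' Set.Ioi (n + 1),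
          ∫⁻ y, F (knownPath X e k n ω, y) ∂(densityLaw μ f₀) ∂P := by
  rw [setLIntegral_preimage_eq_tsum (h.measurable_t k),
    setLIntegral_preimage_eq_tsum (h.measurable_t k)]
  refine tsum_congr fun m => ?_
  rw [setLIntegral_knownPath_obs_singleton h hf₀ hf₁ e k n m hF, obsLaw, if_pos (Set.mem_Ioi.1 m.2)]

theorem setLIntegral_knownPath_obs_of_le [IsProbabilityMeasure P]
    (h : IsModel P μ f₀ f₁ prior t X) (hf₀ : IsProbDensity μ f₀) (hf₁ : IsProbDensity μ f₁)
    (e : E) (k : Fin K) (n : ℕ)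
    {F : (Fin K → ℕ → E) × E → ENNReal} (hF : Measurable F) :
    ∫⁻ ω in (t k ⁻¹' Set.Ioi (n + 1))ᶜ, F (knownPath X e k n ω, X k (n + 1) ω) ∂P
      = ∫⁻ ω in (t k ⁻¹' Set.Ioi (n + 1))ᶜ,
          ∫⁻ y, F (knownPath X e k n ω, y) ∂(densityLaw μ f₁) ∂P := by
  rw [← Set.preimage_compl, setLIntegral_preimage_eq_tsum (h.measurable_t k),
    setLIntegral_preimage_eq_tsum (h.measurable_t k)]
  refine tsum_congr fun m => ?_
  rw [setLIntegral_knownPath_obs_singleton h hf₀ hf₁ e k n m hF, obsLaw, if_neg (fun hm => m.2 (Set.mem_Ioi.2 hm))]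

/-- Given a change after time `n`, its position is independent of the known path: `c` is the
integral of `φ` against the common law from `exists_map_knownPath_cond`. -/
theorem exists_setLIntegral_knownPath [IsProbabilityMeasure P]
    (h : IsModel P μ f₀ f₁ prior t X) (e : E) (k : Fin K) (n : ℕ)
    {φ : (Fin K → ℕ → E) → ENNReal} (hφ : Measurable φ) :
    ∃ c : ENNReal, ∀ S ⊆ Set.Ioi n,
      ∫⁻ ω in t k ⁻¹' S, φ (knownPath X e k n ω) ∂P = prior S * c := by
  obtain ⟨κ, hκ⟩ := exists_map_knownPath_cond h e k n
  refine ⟨∫⁻ u, φ u ∂κ, fun S hS => ?_⟩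
  have h1 (m : ℕ) (hm : n < m) : ∫⁻ ω in t k ⁻¹' {m}, φ (knownPath X e k n ω) ∂P
      = prior {m} * ∫⁻ u, φ u ∂κ := by
    rw [setLIntegral_eq_mul_cond, ← h.law_t k,
      Measure.map_apply (h.measurable_t k) (measurableSet_singleton m)]
    by_cases hm0 : P (t k ⁻¹' {m}) = 0
    · simp [hm0]
    · rw [← lintegral_map hφ (measurable_knownPath h e k n), hκ m hm hm0]
  rw [setLIntegral_preimage_eq_tsum (h.measurable_t k)]
  calc _ = ∑' m : S, prior {(m : ℕ)} * ∫⁻ u, φ u ∂κ := tsum_congr fun m => h1 m (hS m.2)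
    _ = _ := by
      rw [ENNReal.tsum_mul_right]
      congr 1
      simpa using (setLIntegral_preimage_eq_tsum (P := prior) measurable_id S 1).symm

/-- Given that stream `k` has not changed up to time `n`, its change at time `n + 1` is independent
of the past and of the other streams. -/
theorem setLIntegral_knownPath_hazard [IsProbabilityMeasure P] [IsFiniteMeasure prior]
    (h : IsModel P μ f₀ f₁ prior t X) (e : E) (k : Fin K) (n : ℕ)
    {φ : (Fin K → ℕ → E) → ENNReal} (hφ : Measurable φ) :
    (∫⁻ ω in t k ⁻¹' Set.Ioi (n + 1), φ (knownPath X e k n ω) ∂P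
        = ENNReal.ofReal (1 - hazard prior (n + 1))
          * ∫⁻ ω in t k ⁻¹' Set.Ioi n, φ (knownPath X e k n ω) ∂P) ∧
      ∫⁻ ω in t k ⁻¹' {n + 1}, φ (knownPath X e k n ω) ∂P
        = ENNReal.ofReal (hazard prior (n + 1))
          * ∫⁻ ω in t k ⁻¹' Set.Ioi n, φ (knownPath X e k n ω) ∂P := by
  obtain ⟨c, hc⟩ := exists_setLIntegral_knownPath h e k n hφ
  rw [hc _ subset_rfl, hc _ (Set.Ioi_subset_Ioi (by omega)), hc _ (by simp),
    measure_Ioi_succ_eq_mul, measure_singleton_eq_hazard_mul, mul_assoc, mul_assoc]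
  exact ⟨rfl, rfl⟩

end Model

/-! ### The recursion computes the posterior probabilities -/

section Dynamics

variable {Ω E : Type*} {K : ℕ} {f₀ f₁ : E → ℝ} {prior : Measure ℕ} {X : Fin K → ℕ → Ω → E} {α : ℝ}
  {sel : ℕ → (Fin K → ℝ) → Finset (Fin K) → Finset (Fin K)}

/-- The paths of the streams other than `k`, and the state of the procedure at time `n`. -/
def othersState (f₀ f₁ : E → ℝ) (prior : Measure ℕ) (α : ℝ)
    (sel : ℕ → (Fin K → ℝ) → Finset (Fin K) → Finset (Fin K)) (X : Fin K → ℕ → Ω → E) (e : E)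
    (k : Fin K) (n : ℕ) (ω : Ω) : (Fin K → ℕ → E) × ((Fin K → ℝ) × Finset (Fin K)) :=
  (knownPath X e k 0 ω, runPair f₀ f₁ prior α sel (fun j i => X j i ω) n)

/-- `othersState` as a function of the known part of the paths. -/
def othersStateOfPath (f₀ f₁ : E → ℝ) (prior : Measure ℕ) (α : ℝ)
    (sel : ℕ → (Fin K → ℝ) → Finset (Fin K) → Finset (Fin K)) (e : E)
    (k : Fin K) (n : ℕ) (u : Fin K → ℕ → E) :
    (Fin K → ℕ → E) × ((Fin K → ℝ) × Finset (Fin K)) :=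
  (fun j i => if j = k then e else u j i, runPair f₀ f₁ prior α sel u n)

theorem othersStateOfPath_knownPath (e : E) (k : Fin K) (n : ℕ) (ω : Ω) :
    othersStateOfPath f₀ f₁ prior α sel e k n (knownPath X e k n ω)
      = othersState f₀ f₁ prior α sel X e k n ω := by
  refine Prod.ext ?_ (runPair_congr fun j i h1 h2 => ?_)
  · funext j i
    simp only [othersStateOfPath, othersState, knownPath]
    grind
  · simp only [knownPath]
    grind

theorem othersState_eq_comp (e : E) (k : Fin K) (n : ℕ) :
    othersState f₀ f₁ prior α sel X e k n
      = othersStateOfPath f₀ f₁ prior α sel e k n ∘ knownPath X e k n :=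
  funext fun ω => (othersStateOfPath_knownPath e k n ω).symm

/-- The posterior of stream `k` at time `n + 1`, as a function of the state at time `n` and the
observation. -/
def nextPost (f₀ f₁ : E → ℝ) (prior : Measure ℕ)
    (sel : ℕ → (Fin K → ℝ) → Finset (Fin K) → Finset (Fin K)) (k : Fin K) (n : ℕ)
    (r : ((Fin K → ℕ → E) × ((Fin K → ℝ) × Finset (Fin K))) × E) : ℝ :=
  if k ∈ sel (n + 1) r.1.2.1 r.1.2.2 then
    bayesUpdate f₀ f₁ (hazard prior (n + 1)) (r.1.2.1 k) r.2
  else predict (hazard prior (n + 1)) (r.1.2.1 k)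

/-- The state at time `n + 1` as a function of the other streams' paths, the state at time `n` and
the observation of stream `k`. -/
def nextState (f₀ f₁ : E → ℝ) (prior : Measure ℕ) (α : ℝ)
    (sel : ℕ → (Fin K → ℝ) → Finset (Fin K) → Finset (Fin K)) (k : Fin K) (n : ℕ)
    (r : ((Fin K → ℕ → E) × ((Fin K → ℝ) × Finset (Fin K))) × E) :
    (Fin K → ℝ) × Finset (Fin K) :=
  slot f₀ f₁ prior α sel (n + 1) r.1.2 fun j => if j = k then r.2 else r.1.1 j (n + 1)

/-- An observation that is not monitored does not enter the update; the Bayes step may replace it by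
a constant. -/
theorem nextState_congr {k : Fin K} {n : ℕ}
    {z : (Fin K → ℕ → E) × ((Fin K → ℝ) × Finset (Fin K))}
    (hk : k ∉ sel (n + 1) z.2.1 z.2.2) (y y' : E) :
    nextState f₀ f₁ prior α sel k n (z, y) = nextState f₀ f₁ prior α sel k n (z, y') := by
  have : updatePost f₀ f₁ prior (n + 1) (sel (n + 1) z.2.1 z.2.2)
      (fun j => if j = k then y else z.1 j (n + 1)) z.2.1
    = updatePost f₀ f₁ prior (n + 1) (sel (n + 1) z.2.1 z.2.2)
      (fun j => if j = k then y' else z.1 j (n + 1)) z.2.1 := by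
    funext j
    by_cases hj : j = k
    · subst hj
      simp [updatePost, hk]
    · simp [updatePost, hj]
  simp only [nextState, slot, this]

theorem nextState_othersState (e : E) (k : Fin K) (n : ℕ) (ω : Ω) :
    nextState f₀ f₁ prior α sel k n (othersState f₀ f₁ prior α sel X e k n ω, X k (n + 1) ω)
      = runPair f₀ f₁ prior α sel (fun j i => X j i ω) (n + 1) := by
  rw [runPair_succ]
  simp only [nextState, othersState]
  congr 1
  funext j
  by_cases hj : j = k
  · simp [hj]
  · simp [hj, knownPath]

theorem nextPost_othersState (e : E) (k : Fin K) (n : ℕ) (ω : Ω) :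
    nextPost f₀ f₁ prior sel k n (othersState f₀ f₁ prior α sel X e k n ω, X k (n + 1) ω)
      = (runPair f₀ f₁ prior α sel (fun j i => X j i ω) (n + 1)).1 k :=
  rfl

end Dynamics

/-! ### Induction on time for the conditional probabilities of change. -/

section Posterior

variable {Ω E : Type*} [MeasurableSpace Ω] [MeasurableSpace E] {K : ℕ}
  {P : Measure Ω} {μ : Measure E} {f₀ f₁ : E → ℝ} {prior : Measure ℕ}
  {t : Fin K → Ω → ℕ} {X : Fin K → ℕ → Ω → E} {α q : ℝ}
  {sel : ℕ → (Fin K → ℝ) → Finset (Fin K) → Finset (Fin K)}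

theorem measurable_othersStateOfPath (hf₀ : Measurable f₀) (hf₁ : Measurable f₁)
    (hsel : IsTopSelection q sel) (e : E) (k : Fin K) (n : ℕ) :
    Measurable (othersStateOfPath f₀ f₁ prior α sel e k n) := by
  refine Measurable.prodMk ?_ (measurable_runPair hf₀ hf₁ hsel n)
  refine measurable_pi_lambda _ fun j => measurable_pi_lambda _ fun i => ?_
  split_ifs
  · exact measurable_const
  · fun_prop

theorem measurable_othersState (h : IsModel P μ f₀ f₁ prior t X) (hf₀ : Measurable f₀)
    (hf₁ : Measurable f₁) (hsel : IsTopSelection q sel) (e : E) (k : Fin K) (n : ℕ) :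
    Measurable (othersState f₀ f₁ prior α sel X e k n) := by
  rw [othersState_eq_comp]
  exact (measurable_othersStateOfPath hf₀ hf₁ hsel e k n).comp (measurable_knownPath h e k n)

/-- Conditionally on `ζ`, the event `D` has probability `1 - π`. -/
def HasPosterior {Z : Type*} [MeasurableSpace Z] (P : Measure Ω) (ζ : Ω → Z) (D : Set Ω)
    (π : Z → ℝ) : Prop :=
  ∀ φ : Z → ENNReal, Measurable φ →
    ∫⁻ ω in D, φ (ζ ω) ∂P = ∫⁻ ω, ENNReal.ofReal (1 - π (ζ ω)) * φ (ζ ω) ∂P ∧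
    ∫⁻ ω in Dᶜ, φ (ζ ω) ∂P = ∫⁻ ω, ENNReal.ofReal (π (ζ ω)) * φ (ζ ω) ∂P

/-- Passing from `t k > n` to `t k > n + 1` multiplies the conditional probability of no change by
`1 - ρ`, because `othersState` at time `n` is a function of the known path. -/
theorem hasPosterior_predict [IsProbabilityMeasure P] [IsFiniteMeasure prior]
    (h : IsModel P μ f₀ f₁ prior t X) (hf₀ : IsProbDensity μ f₀) (hf₁ : IsProbDensity μ f₁)
    (hsel : IsTopSelection q sel) (e : E) (k : Fin K) (n : ℕ)
    (hn : HasPosterior P (othersState f₀ f₁ prior α sel X e k n) (t k ⁻¹' Set.Ioi n)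
      fun z => z.2.1 k) :
    HasPosterior P (othersState f₀ f₁ prior α sel X e k n) (t k ⁻¹' Set.Ioi (n + 1))
      fun z => predict (hazard prior (n + 1)) (z.2.1 k) := by
  intro φ hφ
  have hZ := measurable_othersState (α := α) h hf₀.measurable hf₁.measurable hsel e k n
  have hρ : hazard prior (n + 1) ∈ Set.Icc (0 : ℝ) 1 := ⟨hazard_nonneg _ _, hazard_le_one _ _⟩
  have hπ (ω : Ω) : (othersState f₀ f₁ prior α sel X e k n ω).2.1 k ∈ Set.Icc (0 : ℝ) 1 :=
    post_mem_Icc hf₀.nonneg hf₁.nonneg _ n k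
  have hπm : Measurable fun ω => (othersState f₀ f₁ prior α sel X e k n ω).2.1 k :=
    (measurable_pi_apply k).comp hZ.snd.fst
  have hφZ : Measurable fun ω => φ (othersState f₀ f₁ prior α sel X e k n ω) := hφ.comp hZ
  obtain ⟨h1, h2⟩ := setLIntegral_knownPath_hazard h e k n
    (hφ.comp (measurable_othersStateOfPath (prior := prior) (α := α) hf₀.measurable hf₁.measurable
      hsel e k n))
  simp only [Function.comp_apply, othersStateOfPath_knownPath] at h1 h2
  obtain ⟨h3, h4⟩ := hn φ hφ
  constructor
  · rw [h1, h3, ← lintegral_const_mul _ (by fun_prop)]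
    refine lintegral_congr fun ω => ?_
    rw [← mul_assoc, ← ENNReal.ofReal_mul (by linarith [hρ.2])]
    congr 2
    unfold predict
    ring
  · have e1 : (t k ⁻¹' Set.Ioi (n + 1))ᶜ = (t k ⁻¹' Set.Ioi n)ᶜ ∪ t k ⁻¹' {n + 1} := by
      ext ω
      simp only [Set.mem_compl_iff, Set.mem_preimage, Set.mem_Ioi, Set.mem_union,
        Set.mem_singleton_iff]
      lia
    have hdisj : Disjoint (t k ⁻¹' Set.Ioi n)ᶜ (t k ⁻¹' {n + 1}) := by
      refine Set.disjoint_left.2 fun ω hω hω' => ?_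
      simp only [Set.mem_compl_iff, Set.mem_preimage, Set.mem_Ioi, Set.mem_singleton_iff] at hω hω'
      lia
    rw [e1, lintegral_union (h.measurable_t k (measurableSet_singleton _)) hdisj, h4, h2, h3,
      ← lintegral_const_mul _ (by fun_prop), ← lintegral_add_left (by fun_prop)]
    refine lintegral_congr fun ω => ?_
    have := hπ ω
    rw [← mul_assoc, ← ENNReal.ofReal_mul hρ.1, ← add_mul,
      ← ENNReal.ofReal_add this.1 (mul_nonneg hρ.1 (by linarith [this.2]))]
    rfl

/-- One time slot. Where `k` is monitored, Bayes' formula turns the predicted probability into the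
updated one. Elsewhere `hFk` makes `F` blind to the observation, and the predicted probability is
final. -/
theorem setLIntegral_obs_eq_nextPost [IsProbabilityMeasure P] [IsFiniteMeasure prior]
    [SigmaFinite μ]
    (h : IsModel P μ f₀ f₁ prior t X) (hf₀ : IsProbDensity μ f₀) (hf₁ : IsProbDensity μ f₁)
    (hsel : IsTopSelection q sel) (e : E) (k : Fin K) (n : ℕ)
    (hn : HasPosterior P (othersState f₀ f₁ prior α sel X e k n) (t k ⁻¹' Set.Ioi n)
      fun z => z.2.1 k)
    {F : ((Fin K → ℕ → E) × ((Fin K → ℝ) × Finset (Fin K))) × E → ENNReal} (hF : Measurable F)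
    (hFk : ∀ z y y', k ∉ sel (n + 1) z.2.1 z.2.2 → F (z, y) = F (z, y')) :
    ∫⁻ ω in t k ⁻¹' Set.Ioi (n + 1),
        F (othersState f₀ f₁ prior α sel X e k n ω, X k (n + 1) ω) ∂P
      = ∫⁻ ω, ENNReal.ofReal (1 - nextPost f₀ f₁ prior sel k n
            (othersState f₀ f₁ prior α sel X e k n ω, X k (n + 1) ω))
          * F (othersState f₀ f₁ prior α sel X e k n ω, X k (n + 1) ω) ∂P ∧
    ∫⁻ ω in (t k ⁻¹' Set.Ioi (n + 1))ᶜ,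
        F (othersState f₀ f₁ prior α sel X e k n ω, X k (n + 1) ω) ∂P
      = ∫⁻ ω, ENNReal.ofReal (nextPost f₀ f₁ prior sel k n
            (othersState f₀ f₁ prior α sel X e k n ω, X k (n + 1) ω))
          * F (othersState f₀ f₁ prior α sel X e k n ω, X k (n + 1) ω) ∂P := by
  have hD : MeasurableSet (t k ⁻¹' Set.Ioi (n + 1)) := h.measurable_t k measurableSet_Ioi
  have hZ := measurable_othersState (α := α) h hf₀.measurable hf₁.measurable hsel e k n
  have hZp := measurable_othersStateOfPath (prior := prior) (α := α) hf₀.measurable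
    hf₁.measurable hsel e k n
  have hX := h.measurable_X k (n + 1) (by omega)
  have hρ : hazard prior (n + 1) ∈ Set.Icc (0 : ℝ) 1 := ⟨hazard_nonneg _ _, hazard_le_one _ _⟩
  have hπ (ω : Ω) : (othersState f₀ f₁ prior α sel X e k n ω).2.1 k ∈ Set.Icc (0 : ℝ) 1 :=
    post_mem_Icc hf₀.nonneg hf₁.nonneg _ n k
  have hpred := hasPosterior_predict h hf₀ hf₁ hsel e k n hn
  have hDY (G : ((Fin K → ℕ → E) × ((Fin K → ℝ) × Finset (Fin K))) × E → ENNReal)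
      (hG : Measurable G) := setLIntegral_knownPath_obs_of_lt h hf₀ hf₁ e k n
    (hG.comp ((hZp.comp measurable_fst).prodMk measurable_snd))
  have hDY' (G : ((Fin K → ℕ → E) × ((Fin K → ℝ) × Finset (Fin K))) × E → ENNReal)
      (hG : Measurable G) := setLIntegral_knownPath_obs_of_le h hf₀ hf₁ e k n
    (hG.comp ((hZp.comp measurable_fst).prodMk measurable_snd))
  simp only [Function.comp_apply, othersStateOfPath_knownPath] at hDY hDY'
  set Z := othersState f₀ f₁ prior α sel X e k n with hZdef
  let ρ := hazard prior (n + 1)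
  let b : ((Fin K → ℕ → E) × ((Fin K → ℝ) × Finset (Fin K))) × E → ℝ :=
    fun r => bayesUpdate f₀ f₁ ρ (r.1.2.1 k) r.2
  have hpk : Measurable fun z : (Fin K → ℕ → E) × ((Fin K → ℝ) × Finset (Fin K)) => z.2.1 k :=
    (measurable_pi_apply k).comp measurable_snd.fst
  have hb : Measurable b := by
    have h0 := hf₀.measurable
    have h1 := hf₁.measurable
    have hpk' : Measurable fun r : ((Fin K → ℕ → E) × ((Fin K → ℝ) × Finset (Fin K))) × E =>
        r.1.2.1 k := hpk.comp measurable_fst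
    simp only [b, bayesUpdate]
    fun_prop
  have hb01 (ω : Ω) (y : E) : b (Z ω, y) ∈ Set.Icc (0 : ℝ) 1 :=
    bayesUpdate_mem_Icc hf₀.nonneg hf₁.nonneg hρ (hπ ω) y
  have hbe (ω : Ω) (y : E) := bayesUpdate_mul hf₀.nonneg hf₁.nonneg hρ (hπ ω) y
  have hc (ω : Ω) := (predict_mem_Icc hρ (hπ ω)).1
  have ha (ω : Ω) : 0 ≤ 1 - predict ρ ((Z ω).2.1 k) := by
    linarith [(predict_mem_Icc hρ (hπ ω)).2]
  have hcm : Measurable fun z : (Fin K → ℕ → E) × ((Fin K → ℝ) × Finset (Fin K)) =>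
      predict ρ (z.2.1 k) := by
    unfold predict
    fun_prop
  let A : Set (((Fin K → ℕ → E) × ((Fin K → ℝ) × Finset (Fin K))) × E) :=
    {r | k ∈ sel (n + 1) r.1.2.1 r.1.2.2}
  have hA : MeasurableSet A := by
    have hmem : MeasurableSet {s : Finset (Fin K) | k ∈ s} := MeasurableSet.of_discrete
    exact ((measurable_sel hsel (n + 1)).comp measurable_fst.snd) hmem
  have hF₁ : Measurable (A.indicator F) := hF.indicator hA
  have hF₂ : Measurable fun z : (Fin K → ℕ → E) × ((Fin K → ℝ) × Finset (Fin K)) =>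
      Aᶜ.indicator F (z, e) := (hF.indicator hA.compl).comp (by fun_prop)
  -- Monitored part plus unmonitored part; in the latter the observation is replaced by the filler
  -- `e`, so that it depends on `Z` alone.
  have hsplit (ω : Ω) : F (Z ω, X k (n + 1) ω)
      = A.indicator F (Z ω, X k (n + 1) ω) + Aᶜ.indicator F (Z ω, e) := by
    by_cases hk : k ∈ sel (n + 1) (Z ω).2.1 (Z ω).2.2
    · have h1 : (Z ω, X k (n + 1) ω) ∈ A := hk
      have h2 : (Z ω, e) ∉ Aᶜ := fun hh => hh hk
      rw [Set.indicator_of_mem h1, Set.indicator_of_notMem h2, add_zero]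
    · have h1 : (Z ω, X k (n + 1) ω) ∉ A := hk
      have h2 : (Z ω, e) ∈ Aᶜ := hk
      rw [Set.indicator_of_notMem h1, Set.indicator_of_mem h2, zero_add]
      exact hFk _ _ _ hk
  have hF₁m : Measurable fun ω => A.indicator F (Z ω, X k (n + 1) ω) :=
    hF₁.comp (hZ.prodMk hX)
  have hbm : Measurable fun ω => b (Z ω, X k (n + 1) ω) := hb.comp (hZ.prodMk hX)
  obtain ⟨hP₂, hP₂'⟩ := hpred _ hF₂
  have combine (g : ℝ → ℝ) (hg : Measurable g) (S : Set Ω)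
      (e1 : ∫⁻ ω in S, A.indicator F (Z ω, X k (n + 1) ω) ∂P
        = ∫⁻ ω, ENNReal.ofReal (g (b (Z ω, X k (n + 1) ω)))
          * A.indicator F (Z ω, X k (n + 1) ω) ∂P)
      (e2 : ∫⁻ ω in S, Aᶜ.indicator F (Z ω, e) ∂P
        = ∫⁻ ω, ENNReal.ofReal (g (predict ρ ((Z ω).2.1 k))) * Aᶜ.indicator F (Z ω, e) ∂P) :
      ∫⁻ ω in S, F (Z ω, X k (n + 1) ω) ∂P
        = ∫⁻ ω, ENNReal.ofReal (g (nextPost f₀ f₁ prior sel k n (Z ω, X k (n + 1) ω)))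
          * F (Z ω, X k (n + 1) ω) ∂P := by
    simp_rw [hsplit]
    rw [lintegral_add_left hF₁m, e1, e2, ← lintegral_add_left (by fun_prop)]
    refine lintegral_congr fun ω => ?_
    by_cases hk : k ∈ sel (n + 1) (Z ω).2.1 (Z ω).2.2
    · have h2 : (Z ω, e) ∉ Aᶜ := fun hh => hh hk
      rw [Set.indicator_of_notMem h2, mul_zero, add_zero, add_zero, nextPost, if_pos hk]
    · have h1 : (Z ω, X k (n + 1) ω) ∉ A := hk
      rw [Set.indicator_of_notMem h1, mul_zero, zero_add, zero_add, nextPost, if_neg hk]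
  constructor
  · refine combine (fun x => 1 - x) (by fun_prop) _ ?_ hP₂
    refine setLIntegral_eq_lintegral_posterior (μ := μ) (w := fun r => 1 - b r)
      (a := fun z => 1 - predict ρ (z.2.1 k)) (c := fun z => predict ρ (z.2.1 k))
      hf₀.measurable hf₁.measurable hf₀.nonneg hf₁.nonneg hD hZ (by fun_prop) hcm ha hc
      hDY hDY' (fun φ hφ => (hpred φ hφ).1) (fun φ hφ => (hpred φ hφ).2)
      (by fun_prop) (fun ω y => by linarith [(hb01 ω y).2]) (fun ω y => ?_) hF₁
    have := hbe ω y
    simp only [b, predict, ρ] at this ⊢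
    linear_combination -this
  -- The same Bayes lemma with `D` and `Dᶜ`, and with `f₀` and `f₁`, interchanged.
  · refine combine (fun x => x) (by fun_prop) _ ?_ hP₂'
    refine setLIntegral_eq_lintegral_posterior (μ := μ) (w := b)
      (a := fun z => predict ρ (z.2.1 k)) (c := fun z => 1 - predict ρ (z.2.1 k))
      hf₁.measurable hf₀.measurable hf₁.nonneg hf₀.nonneg hD.compl hZ hcm (by fun_prop) hc ha
      hDY' (by simpa using hDY) (fun φ hφ => (hpred φ hφ).2)
      (fun φ hφ => by simpa using (hpred φ hφ).1)
      hb (fun ω y => (hb01 ω y).1) (fun ω y => ?_) hF₁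
    have := hbe ω y
    simp only [b, predict, ρ] at this ⊢
    linear_combination this

theorem measurable_nextState (hf₀ : Measurable f₀) (hf₁ : Measurable f₁)
    (hsel : IsTopSelection q sel) (k : Fin K) (n : ℕ) :
    Measurable (nextState f₀ f₁ prior α sel k n) := by
  have hy : Measurable fun (r : ((Fin K → ℕ → E) × ((Fin K → ℝ) × Finset (Fin K))) × E)
      (j : Fin K) => if j = k then r.2 else r.1.1 j (n + 1) := by
    refine measurable_pi_lambda _ fun j => ?_
    split_ifs
    · exact measurable_snd
    · exact (measurable_pi_apply (n + 1)).comp ((measurable_pi_apply j).comp measurable_fst.fst)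
  exact (measurable_slot hf₀ hf₁ hsel (n + 1)).comp (measurable_fst.snd.prodMk hy)

/-- The posterior recursion computes the conditional probabilities of change, given the state of
the procedure and the paths of the other streams. -/
theorem hasPosterior_othersState [IsProbabilityMeasure P] [IsFiniteMeasure prior]
    [SigmaFinite μ]
    (h : IsModel P μ f₀ f₁ prior t X) (hf₀ : IsProbDensity μ f₀) (hf₁ : IsProbDensity μ f₁)
    (hsel : IsTopSelection q sel) (e : E) (k : Fin K) (n : ℕ) :
    HasPosterior P (othersState f₀ f₁ prior α sel X e k n) (t k ⁻¹' Set.Ioi n)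
      fun z => z.2.1 k := by
  induction n with
  | zero =>
    intro φ hφ
    -- The initial posterior `0` is correct because change points are almost surely at least `1`.
    have h0 : P (t k ⁻¹' Set.Ioi 0)ᶜ = 0 := by
      have e1 : (t k ⁻¹' Set.Ioi 0)ᶜ = t k ⁻¹' {0} := by ext; simp
      rw [e1, ← Measure.map_apply (h.measurable_t k) (measurableSet_singleton 0), h.law_t k,
        h.prior_zero]
    have hpost (ω : Ω) : (othersState f₀ f₁ prior α sel X e k 0 ω).2.1 k = 0 := rfl
    simp only [hpost, sub_zero, ENNReal.ofReal_one, one_mul, ENNReal.ofReal_zero, zero_mul,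
      lintegral_zero]
    refine ⟨?_, setLIntegral_measure_zero _ _ h0⟩
    have hu : (t k ⁻¹' Set.Ioi 0 : Set Ω) =ᵐ[P] Set.univ := by
      rw [ae_eq_univ]
      exact h0
    rw [Measure.restrict_congr_set hu, Measure.restrict_univ]
  | succ n ih =>
    intro φ hφ
    let F : ((Fin K → ℕ → E) × ((Fin K → ℝ) × Finset (Fin K))) × E → ENNReal :=
      fun r => φ (r.1.1, nextState f₀ f₁ prior α sel k n r)
    have hF : Measurable F := hφ.comp (measurable_fst.fst.prodMk
      (measurable_nextState hf₀.measurable hf₁.measurable hsel k n))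
    have := setLIntegral_obs_eq_nextPost h hf₀ hf₁ hsel e k n ih hF
      fun z y y' hk => by simp only [F, nextState_congr hk y y']
    simp only [F, nextState_othersState, nextPost_othersState] at this
    exact this

end Posterior

/-! ### Control of the false discovery rate -/

section Deterministic

variable {E : Type*} {K : ℕ} {f₀ f₁ : E → ℝ} {prior : Measure ℕ} {α : ℝ}
  {sel : ℕ → (Fin K → ℝ) → Finset (Fin K) → Finset (Fin K)} {x : Fin K → ℕ → E} {k : Fin K}

theorem antitone_active : Antitone fun n => (runPair f₀ f₁ prior α sel x n).2 :=
  antitone_nat_of_succ_le fun _ => Finset.sdiff_subset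

theorem declTime_lt_iff {m : ℕ∞} :
    declTime f₀ f₁ prior α sel x k < m
      ↔ ∃ n : ℕ, k ∉ (runPair f₀ f₁ prior α sel x n).2 ∧ (n : ℕ∞) < m := by
  simp only [declTime, iInf_lt_iff, runPair, exists_prop]

theorem exists_declared_of_notMem {n : ℕ} (h : k ∉ (runPair f₀ f₁ prior α sel x n).2) :
    ∃ j < n, k ∈ (runPair f₀ f₁ prior α sel x j).2 ∧
      k ∉ (runPair f₀ f₁ prior α sel x (j + 1)).2 := by
  induction n with
  | zero => simp [runPair, run] at h
  | succ n ih =>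
    by_cases hk : k ∈ (runPair f₀ f₁ prior α sel x n).2
    · exact ⟨n, by omega, hk, h⟩
    · obtain ⟨j, hj, h'⟩ := ih hk
      exact ⟨j, by omega, h'⟩

/-- The reciprocal of the number of streams declared so far if stream `k` has just been declared,
where `A` and `B` are the sets of active streams before and after the present time slot. -/
def declaredWeight (k : Fin K) (A B : Finset (Fin K)) : ENNReal :=
  if k ∈ A ∧ k ∉ B then ((K - B.card : ℕ) : ENNReal)⁻¹ else 0

theorem card_lt_of_notMem {B : Finset (Fin K)} (h : k ∉ B) : B.card < K := by
  have hB : B ⊂ Finset.univ :=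
    (Finset.ssubset_iff_of_subset (Finset.subset_univ B)).2 ⟨k, Finset.mem_univ k, h⟩
  simpa using Finset.card_lt_card hB

theorem card_inactive_le_discoveries (n : ℕ) :
    K - (runPair f₀ f₁ prior α sel x n).2.card ≤ discoveries (declTime f₀ f₁ prior α sel x) := by
  have h : ((runPair f₀ f₁ prior α sel x n).2)ᶜ.card
      ≤ discoveries (declTime f₀ f₁ prior α sel x) := by
    unfold discoveries
    refine Finset.card_le_card fun k hk => ?_
    simp only [Finset.mem_filter, Finset.mem_univ, true_and]
    exact declTime_lt_iff.2 ⟨n, Finset.mem_compl.1 hk, ENat.natCast_lt_top n⟩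
  simpa [Finset.card_compl] using h

/-- The random final count `R` is replaced by the number of streams declared so far, which is known
at the time of the declaration and at most `R`. -/
theorem fdp_declTime_le (τ : Fin K → ℕ) :
    ENNReal.ofReal (fdp (declTime f₀ f₁ prior α sel x) τ)
      ≤ ∑ k, ∑' n : ℕ, if n + 1 < τ k then
          declaredWeight k (runPair f₀ f₁ prior α sel x n).2
            (runPair f₀ f₁ prior α sel x (n + 1)).2 else 0 := by
  classical
  set T := declTime f₀ f₁ prior α sel x with hT
  have e : fdp T τ = ∑ k, if T k < (τ k : ℕ∞) then (max (discoveries T : ℝ) 1)⁻¹ else 0 := by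
    rw [fdp, falseDiscoveries, ← Finset.sum_filter, Finset.sum_const, nsmul_eq_mul, div_eq_mul_inv]
  have hR : (0 : ℝ) < max (discoveries T : ℝ) 1 := lt_max_of_lt_right one_pos
  rw [e, ENNReal.ofReal_sum_of_nonneg fun k _ => by split_ifs <;> positivity]
  refine Finset.sum_le_sum fun k _ => ?_
  split_ifs with hk
  · obtain ⟨m, hm, hmτ⟩ := declTime_lt_iff.1 hk
    obtain ⟨n, hn, h1, h2⟩ := exists_declared_of_notMem hm
    have hτ : n + 1 < τ k := lt_of_le_of_lt hn (by exact_mod_cast hmτ)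
    refine le_trans ?_ (ENNReal.le_tsum n)
    rw [if_pos hτ, declaredWeight, if_pos ⟨h1, h2⟩, ENNReal.ofReal_inv_of_pos hR,
      ENNReal.inv_le_inv, ← ENNReal.ofReal_natCast]
    refine ENNReal.ofReal_le_ofReal (le_trans ?_ (le_max_left _ _))
    exact_mod_cast card_inactive_le_discoveries (n + 1)
  · simp

/-- The weight is `1 / r` for the same `r` whose threshold `Q_r` the declared stream has passed, so
`r` cancels. -/
theorem one_sub_post_mul_declaredWeight_le (hα : 0 ≤ α) (n : ℕ) :
    ENNReal.ofReal (1 - (runPair f₀ f₁ prior α sel x (n + 1)).1 k)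
        * declaredWeight k (runPair f₀ f₁ prior α sel x n).2
          (runPair f₀ f₁ prior α sel x (n + 1)).2
      ≤ if k ∈ (runPair f₀ f₁ prior α sel x n).2 ∧
          k ∉ (runPair f₀ f₁ prior α sel x (n + 1)).2 then ENNReal.ofReal (α / K) else 0 := by
  unfold declaredWeight
  split_ifs with h
  · set r := K - (runPair f₀ f₁ prior α sel x (n + 1)).2.card with hr
    have hr0 : r ≠ 0 := by have := card_lt_of_notMem h.2; omega
    have hk : k ∈ declared α (runPair f₀ f₁ prior α sel x (n + 1)).1
        (runPair f₀ f₁ prior α sel x n).2 := by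
      by_contra hc
      exact h.2 (Finset.mem_sdiff.2 ⟨h.1, hc⟩)
    have ht : threshold K α r ≤ (runPair f₀ f₁ prior α sel x (n + 1)).1 k :=
      threshold_le_of_mem_declared hα hk
    have hle : 1 - (runPair f₀ f₁ prior α sel x (n + 1)).1 k ≤ α / K * r := by
      unfold threshold at ht
      have : (r : ℝ) * α / K = α / K * r := by ring
      linarith
    calc _ ≤ ENNReal.ofReal (α / K * r) * (r : ENNReal)⁻¹ := by gcongr
      _ = ENNReal.ofReal (α / K) := by
        rw [ENNReal.ofReal_mul (by positivity), ENNReal.ofReal_natCast, mul_assoc,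
          ENNReal.mul_inv_cancel (by exact_mod_cast hr0) (ENNReal.natCast_ne_top r), mul_one]
  · simp

theorem smapFDP_nonneg {Ω : Type*} {t : Fin K → Ω → ℕ} {X : Fin K → ℕ → Ω → E} (ω : Ω) : 0 ≤ smapFDP f₀ f₁ prior α sel t X ω := by
  unfold smapFDP fdp
  positivity

end Deterministic

/-! ### Measurability of the false discovery proportion and the bound on its expectation. -/

section FDR

variable {Ω E : Type*} [MeasurableSpace Ω] [MeasurableSpace E] {K : ℕ}
  {P : Measure Ω} {μ : Measure E} {f₀ f₁ : E → ℝ} {prior : Measure ℕ}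
  {t : Fin K → Ω → ℕ} {X : Fin K → ℕ → Ω → E} {α q : ℝ}
  {sel : ℕ → (Fin K → ℝ) → Finset (Fin K) → Finset (Fin K)}

/-- Supplies the filler value for erased observations. -/
theorem nonempty_of_isProbDensity {f : E → ℝ} (hf : IsProbDensity μ f) : Nonempty E := by
  by_contra hE
  rw [not_nonempty_iff] at hE
  have := hf.lintegral_eq_one
  simp at this

theorem measurable_active (h : IsModel P μ f₀ f₁ prior t X) (hf₀ : IsProbDensity μ f₀)
    (hf₁ : IsProbDensity μ f₁) (hsel : IsTopSelection q sel) (n : ℕ) :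
    Measurable fun ω => (runPair f₀ f₁ prior α sel (fun j i => X j i ω) n).2 := by
  obtain ⟨e⟩ := nonempty_of_isProbDensity hf₀
  exact measurable_finset_of_mem fun k =>
    (measurable_othersState (α := α) h hf₀.measurable hf₁.measurable hsel e k n).snd.snd
      (MeasurableSet.of_discrete (s := {A : Finset (Fin K) | k ∈ A}))

theorem measurable_smapFDP (h : IsModel P μ f₀ f₁ prior t X) (hf₀ : IsProbDensity μ f₀)
    (hf₁ : IsProbDensity μ f₁) (hsel : IsTopSelection q sel) :
    Measurable (smapFDP f₀ f₁ prior α sel t X) := by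
  classical
  have hact (k : Fin K) (n : ℕ) : MeasurableSet
      {ω | k ∉ (runPair f₀ f₁ prior α sel (fun j i => X j i ω) n).2} :=
    measurable_active h hf₀ hf₁ hsel n
      (MeasurableSet.of_discrete (s := {A : Finset (Fin K) | k ∉ A}))
  let A : Ω → Finset (Fin K) := fun ω => Finset.univ.filter fun k =>
    declTime f₀ f₁ prior α sel (fun j i => X j i ω) k < (t k ω : ℕ∞)
  let B : Ω → Finset (Fin K) := fun ω => Finset.univ.filter fun k =>
    declTime f₀ f₁ prior α sel (fun j i => X j i ω) k < ⊤
  have hA : Measurable A := by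
    refine measurable_finset_of_mem fun k => ?_
    have e1 : {ω | k ∈ A ω} = ⋃ n : ℕ,
        {ω | k ∉ (runPair f₀ f₁ prior α sel (fun j i => X j i ω) n).2} ∩ t k ⁻¹' Set.Ioi n := by
      ext ω
      simp [A, declTime_lt_iff]
    rw [e1]
    exact MeasurableSet.iUnion fun n => (hact k n).inter (h.measurable_t k measurableSet_Ioi)
  have hB : Measurable B := by
    refine measurable_finset_of_mem fun k => ?_
    have e1 : {ω | k ∈ B ω} = ⋃ n : ℕ,
        {ω | k ∉ (runPair f₀ f₁ prior α sel (fun j i => X j i ω) n).2} := by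
      ext ω
      simp [B, declTime_lt_iff]
    rw [e1]
    exact MeasurableSet.iUnion fun n => hact k n
  have hg : Measurable fun r : Finset (Fin K) × Finset (Fin K) =>
      (r.1.card : ℝ) / max (r.2.card : ℝ) 1 := Measurable.of_discrete
  have e2 : smapFDP f₀ f₁ prior α sel t X
      = fun ω => ((A ω).card : ℝ) / max ((B ω).card : ℝ) 1 := by
    funext ω
    simp only [smapFDP, fdp, falseDiscoveries, discoveries, A, B]
  rw [e2]
  exact hg.comp (hA.prodMk hB)

/-- The expected contribution of stream `k` to the false discovery proportion. -/
theorem tsum_setLIntegral_declaredWeight_le [IsProbabilityMeasure P] [IsFiniteMeasure prior]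
    [SigmaFinite μ]
    (h : IsModel P μ f₀ f₁ prior t X) (hf₀ : IsProbDensity μ f₀) (hf₁ : IsProbDensity μ f₁)
    (hsel : IsTopSelection q sel) (hα : 0 ≤ α) (k : Fin K) :
    ∑' n : ℕ, ∫⁻ ω in t k ⁻¹' Set.Ioi (n + 1),
        declaredWeight k (runPair f₀ f₁ prior α sel (fun j i => X j i ω) n).2
          (runPair f₀ f₁ prior α sel (fun j i => X j i ω) (n + 1)).2 ∂P
      ≤ ENNReal.ofReal (α / K) := by
  obtain ⟨e⟩ := nonempty_of_isProbDensity hf₀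
  let D : ℕ → Set Ω := fun n => {ω | k ∈ (runPair f₀ f₁ prior α sel (fun j i => X j i ω) n).2 ∧
    k ∉ (runPair f₀ f₁ prior α sel (fun j i => X j i ω) (n + 1)).2}
  have hD (n : ℕ) : MeasurableSet (D n) :=
    (measurable_active h hf₀ hf₁ hsel n
      (MeasurableSet.of_discrete (s := {A : Finset (Fin K) | k ∈ A}))).inter
    (measurable_active h hf₀ hf₁ hsel (n + 1)
      (MeasurableSet.of_discrete (s := {A : Finset (Fin K) | k ∉ A})))
  -- Active sets only shrink, so a stream leaves them at most once; this bounds the sum of the `P (D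
  -- n)` by `1`.
  have hdisj : Pairwise (Function.onFun Disjoint D) := by
    refine (pairwise_disjoint_on D).2 fun m n hmn => Set.disjoint_left.2 fun ω hm hn => ?_
    exact hm.2 (antitone_active (by omega : m + 1 ≤ n) hn.1)
  have hterm (n : ℕ) : ∫⁻ ω in t k ⁻¹' Set.Ioi (n + 1),
        declaredWeight k (runPair f₀ f₁ prior α sel (fun j i => X j i ω) n).2
          (runPair f₀ f₁ prior α sel (fun j i => X j i ω) (n + 1)).2 ∂P
      ≤ ENNReal.ofReal (α / K) * P (D n) := by
    let F : ((Fin K → ℕ → E) × ((Fin K → ℝ) × Finset (Fin K))) × E → ENNReal :=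
      fun r => declaredWeight k r.1.2.2 (nextState f₀ f₁ prior α sel k n r).2
    have hF : Measurable F :=
      (Measurable.of_discrete (f := fun r : Finset (Fin K) × Finset (Fin K) =>
        declaredWeight k r.1 r.2)).comp (measurable_fst.snd.snd.prodMk
          (measurable_nextState hf₀.measurable hf₁.measurable hsel k n).snd)
    have := (setLIntegral_obs_eq_nextPost (α := α) h hf₀ hf₁ hsel e k n
      (hasPosterior_othersState h hf₀ hf₁ hsel e k n) hF
      fun z y y' hk => by simp only [F, nextState_congr hk y y']).1
    simp only [F, nextState_othersState, nextPost_othersState] at this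
    refine this.trans_le ((lintegral_mono fun ω =>
      one_sub_post_mul_declaredWeight_le (x := fun j i => X j i ω) hα n).trans_eq ?_)
    rw [← lintegral_indicator_const (hD n)]
    refine lintegral_congr fun ω => ?_
    rw [Set.indicator_apply]
    rfl
  calc _ ≤ ∑' n, ENNReal.ofReal (α / K) * P (D n) := ENNReal.tsum_le_tsum hterm
    _ = ENNReal.ofReal (α / K) * P (⋃ n, D n) := by
      rw [ENNReal.tsum_mul_left, measure_iUnion hdisj hD]
    _ ≤ ENNReal.ofReal (α / K) := mul_le_of_le_one_right' prob_le_one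

theorem lintegral_smapFDP_le [IsProbabilityMeasure P] [IsFiniteMeasure prior] [SigmaFinite μ]
    (h : IsModel P μ f₀ f₁ prior t X) (hf₀ : IsProbDensity μ f₀) (hf₁ : IsProbDensity μ f₁)
    (hsel : IsTopSelection q sel) (hα : 0 ≤ α) :
    ∫⁻ ω, ENNReal.ofReal (smapFDP f₀ f₁ prior α sel t X ω) ∂P ≤ ENNReal.ofReal α := by
  classical
  have hw (k : Fin K) (n : ℕ) : Measurable fun ω =>
      declaredWeight k (runPair f₀ f₁ prior α sel (fun j i => X j i ω) n).2
        (runPair f₀ f₁ prior α sel (fun j i => X j i ω) (n + 1)).2 :=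
    (Measurable.of_discrete (f := fun r : Finset (Fin K) × Finset (Fin K) =>
      declaredWeight k r.1 r.2)).comp ((measurable_active h hf₀ hf₁ hsel n).prodMk
        (measurable_active h hf₀ hf₁ hsel (n + 1)))
  have hD (k : Fin K) (n : ℕ) : MeasurableSet {ω | n + 1 < t k ω} :=
    h.measurable_t k measurableSet_Ioi
  have hm (k : Fin K) (n : ℕ) : Measurable fun ω => if n + 1 < t k ω then
      declaredWeight k (runPair f₀ f₁ prior α sel (fun j i => X j i ω) n).2
        (runPair f₀ f₁ prior α sel (fun j i => X j i ω) (n + 1)).2 else 0 :=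
    Measurable.ite (hD k n) (hw k n) measurable_const
  refine (lintegral_mono fun ω => fdp_declTime_le _).trans ?_
  rw [lintegral_finsetSum _ fun k _ => Measurable.tsum fun n => hm k n]
  calc _ ≤ ∑ _k : Fin K, ENNReal.ofReal (α / K) := by
        refine Finset.sum_le_sum fun k _ => ?_
        rw [lintegral_tsum fun n => (hm k n).aemeasurable]
        refine le_of_eq_of_le (tsum_congr fun n => ?_)
          (tsum_setLIntegral_declaredWeight_le h hf₀ hf₁ hsel hα k)
        rw [← lintegral_indicator (h.measurable_t k measurableSet_Ioi)]
        refine lintegral_congr fun ω => ?_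
        rw [Set.indicator_apply]
        congr
    _ = ENNReal.ofReal (K * (α / K)) := by
        rw [ENNReal.ofReal_mul (by positivity)]
        simp
    -- An inequality only because `K = 0` is allowed, where `K / K = 0`.
    _ ≤ ENNReal.ofReal α := by
        refine ENNReal.ofReal_le_ofReal ?_
        rw [mul_div_left_comm]
        exact mul_le_of_le_one_right hα (div_self_le_one _)

end FDR

end SMAP

end

theorem theorem1 {Ω E : Type*} [MeasurableSpace Ω] [MeasurableSpace E] {K : ℕ}
    (P : Measure Ω) [IsProbabilityMeasure P]
    (μ : Measure E) [SigmaFinite μ] (f₀ f₁ : E → ℝ)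
    (hf₀ : SMAP.IsProbDensity μ f₀) (hf₁ : SMAP.IsProbDensity μ f₁)
    (prior : Measure ℕ) [IsProbabilityMeasure prior]
    (t : Fin K → Ω → ℕ) (X : Fin K → ℕ → Ω → E)
    (hmodel : SMAP.IsModel P μ f₀ f₁ prior t X)
    (α : ℝ) (hα : α ∈ Set.Ioo (0 : ℝ) 1) (q : ℝ) (hq : q ∈ Set.Icc (0 : ℝ) 1)
    (sel : ℕ → (Fin K → ℝ) → Finset (Fin K) → Finset (Fin K))
    (hsel : SMAP.IsTopSelection q sel) :
    Integrable (SMAP.smapFDP f₀ f₁ prior α sel t X) P ∧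
      SMAP.smapFDR P f₀ f₁ prior α sel t X ≤ α := by
  have hm := SMAP.measurable_smapFDP (α := α) hmodel hf₀ hf₁ hsel
  have h0 : 0 ≤ᵐ[P] SMAP.smapFDP f₀ f₁ prior α sel t X :=
    Filter.Eventually.of_forall fun ω => SMAP.smapFDP_nonneg ω
  have hle := SMAP.lintegral_smapFDP_le hmodel hf₀ hf₁ hsel hα.1.le
  refine ⟨⟨hm.aestronglyMeasurable, ?_⟩, ?_⟩
  · rw [hasFiniteIntegral_iff_ofReal h0]
    exact hle.trans_lt ENNReal.ofReal_lt_top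
  · rw [SMAP.smapFDR, integral_eq_lintegral_of_nonneg_ae h0 hm.aestronglyMeasurable]
    exact ENNReal.toReal_le_of_le_ofReal hα.1.le hle
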